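/- All manifolds and Lie groups are smooth, Hausdorff, possibly infinite-dimensional, modelled on Hausdorff locally convex real vector spaces (smoothness in the sense of Michal--Bastiani). **Setting.** Let $G$ be a Lie group with Lie algebra $\mathfrak g$ (bracket of left-invariant vector fields) acting smoothly from the left on a manifold $M$ and preserving a (weakly) symplectic form $\omega$. Let $\mathfrak g^*$ be a locally convex space with a continuous non-degenerate bilinear pairing $\kappa:\mathfrak g^*\times\mathfrak g\to\mathbb R$ for which the coadjoint action $\mathrm{Ad}^*$ of $G$ on $\mathfrak g^*$ exists, i.e. $\kappa(\mathrm{Ad}^*_{g^{-1}}\mu,\mathrm{Ad}_g\xi)=\kappa(\mu,\xi)$. Let $J:M\to\mathfrak g^*$ be a smooth momentum map: $\omega_x(\xi\cdot x,X)+\kappa(T_xJ(X),\xi)=0$ for all $x\in M$, $X\in T_xM$, $\xi\in\mathfrak g$. Let $\sigma(g)=J(g\cdot x)-\mathrm{Ad}^*_{g^{-1}}J(x)$ be its non-equivariance cocycle. A *Klein pair* $(\mathfrak a,\mathfrak g)$ *with group* $G$ is a locally convex topological Lie algebra $\mathfrak a$ containing $\mathfrak g$ as a closed, topologically complemented Lie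 subalgebra, together with a smooth linear representation $\mathrm{Ad}$ of $G$ on $\mathfrak a$ which restricts to the adjoint representation on $\mathfrak g$. A *duality* of it is a continuous bilinear map $\kappa_{\mathfrak a}:\mathfrak g^*\times\mathfrak a\to\mathbb R$ which vanishes on $\mathfrak g^*\times\mathfrak g$ and satisfies $\kappa_{\mathfrak a}(\mathrm{Ad}^*_{g^{-1}}\mu,\mathrm{Ad}_g\xi)=\kappa_{\mathfrak a}(\mu,\xi)$. A *Cartan geometry* modelled on $(\mathfrak a,\mathfrak g)$ is a smooth left principal $G$-bundle $\pi:P\to B$ with a smooth $1$-form $\theta\in\Omega^1(P,\mathfrak a)$ such that every $\theta_p:T_pP\to\mathfrak a$ is an isomorphism of topological vector spaces, $\theta_{g\cdot p}(g\cdot X)=\mathrm{Ad}_g\theta_p(X)$, and $\theta(\xi^*)=\xi$ for the fundamental vector field $\xi^*$ of every $\xi\in\mathfrak g$. Its curvature is $\Omega=d\theta-\tfrac12[\theta\wedge\theta]$, i.e. $\Omega(X,Y)=d\theta(X,Y)-[\theta(X),\theta(Y)]$; $\theta$ is *torsion-free* if $\Omega$ takes values in $\mathfrak g$. It is an *orbit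 through* $m\in M$ via $\chi:P\to M$ if $\chi$ is smooth and $G$-equivariant with $m\in\chi(P)$, and there are a Lie subalgebra $\mathfrak a_m\subseteq\mathfrak a$ and a right Lie algebra action $\zeta\mapsto\zeta^*$ of $\mathfrak a_m$ on $P$ (by smooth vector fields, with $[\zeta,\eta]^*=[\zeta^*,\eta^*]$) commuting with the $G$-action and satisfying $T\chi(\zeta^*)=0$. Put $C_p(\xi)=T_{\chi(p)}J\bigl(T_p\chi(\theta_p^{-1}(\xi))\bigr)$ for $p\in P$, $\xi\in\mathfrak a$. The momentum map $J$ is *$\mathfrak a$-equivariant* relative to $\kappa_{\mathfrak a}$ if $$\kappa_{\mathfrak a}(C_p\xi,\eta)-\kappa_{\mathfrak a}(C_p\eta,\xi)=-\kappa_{\mathfrak a}\bigl(J(\chi(p)),[\xi,\eta]\bigr)\quad\text{and}\quad\kappa_{\mathfrak a}(\sigma(g),\xi)=0$$ for all $p\in P$, $\xi,\eta\in\mathfrak a$, $g\in G$. **Theorem.** Let $(P,\theta)$ be a Cartan geometry modelled on $(\mathfrak a,\mathfrak g)$ with group $G$ which is an orbit through $m\in M$ via $\chi$, let $\kappa_{\mathfrak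 a}$ be a duality of $(\mathfrak a,\mathfrak g)$, and assume that $J$ is $\mathfrak a$-equivariant. Then: 1. The smooth $1$-form $\alpha$ on $P$ defined by $\alpha_p(X)=\kappa_{\mathfrak a}\bigl(J(\chi(p)),\theta_p(X)\bigr)$ is basic (it is $G$-invariant and vanishes on $\ker T\pi$), and hence there is a unique $1$-form $\check\alpha$ on $B$ with $\alpha=\pi^*\check\alpha$; it is smooth. 2. $d\alpha=\kappa_{\mathfrak a}(J\circ\chi,\Omega)$. In particular, if $\theta$ is torsion-free, then $d\alpha=0$ and $d\check\alpha=0$. 3. If $B$ is simply connected and $\theta$ is torsion-free, there is a smooth function $\Psi_m:B\to\mathbb R$ with $\check\alpha=d\Psi_m$, and it is unique up to an additive constant (the Kempf--Ness function at $m$). -/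

import Mathlib

open Set Filter Topology

namespace LCGeom

noncomputable section

universe u v

/-! ## Calculus in locally convex spaces

Infinite-dimensional manifolds and Lie groups are modelled on arbitrary Hausdorff locally convex
spaces, with smoothness in the sense of Michal--Bastiani (also known as Keller's `C_c^∞`, or
Hamilton's calculus on Fréchet spaces). -/

/-- Hausdorff locally convex real topological vector spaces. -/
class LocConvex (E : Type*) [AddCommGroup E] [Module ℝ E] [TopologicalSpace E] : Prop extends
  IsTopologicalAddGroup E, ContinuousSMul ℝ E, LocallyConvexSpace ℝ E, T2Space E

/-- `L` is the directional derivative of `f` at `x` in the direction `v`. -/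
def HasDirDeriv {E F : Type*} [AddCommGroup E] [Module ℝ E]
    [AddCommGroup F] [Module ℝ F] [TopologicalSpace F] (f : E → F) (x v : E) (L : F) : Prop :=
  Tendsto (fun t : ℝ => t⁻¹ • (f (x + t • v) - f x)) (𝓝[≠] 0) (𝓝 L)

/-- The directional derivative of `f` at `x` in the direction `v` (meaningful if it exists). -/
def dirDeriv {E F : Type*} [AddCommGroup E] [Module ℝ E]
    [AddCommGroup F] [Module ℝ F] [TopologicalSpace F] (f : E → F) (x v : E) : F :=
  limUnder (𝓝[≠] (0 : ℝ)) (fun t : ℝ => t⁻¹ • (f (x + t • v) - f x))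

/-- `f` is of class `C^n` on the open set `U`: `C^0` means continuous, and `f` is `C^(n+1)` if all
directional derivatives exist on `U` and the differential `(x, v) ↦ df(x)(v)` is `C^n` on
`U × E`. -/
def BastianiC {F : Type v} [AddCommGroup F] [Module ℝ F] [TopologicalSpace F] :
    ℕ → ∀ {E : Type u} [AddCommGroup E] [Module ℝ E] [TopologicalSpace E],
      (E → F) → Set E → Prop
  | 0, _, _, _, _, f, U => ContinuousOn f U
  | n + 1, E, _, _, _, f, U => ContinuousOn f U ∧ ∃ f' : E × E → F,
      (∀ x ∈ U, ∀ v : E, HasDirDeriv f x v (f' (x, v))) ∧ BastianiC n f' (U ×ˢ univ)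

/-- `f` is smooth on the open set `U`. -/
def BSmooth {E : Type u} [AddCommGroup E] [Module ℝ E] [TopologicalSpace E]
    {F : Type v} [AddCommGroup F] [Module ℝ F] [TopologicalSpace F]
    (f : E → F) (U : Set E) : Prop :=
  ∀ n : ℕ, BastianiC n f U

/-! ## Manifolds modelled on locally convex spaces -/

/-- A (Hausdorff) smooth manifold `M` modelled on `E`, given by an atlas. -/
class LCManifold (E : Type*) [AddCommGroup E] [Module ℝ E] [TopologicalSpace E]
    (M : Type*) [TopologicalSpace M] [ChartedSpace E M] : Prop extends T2Space M where
  compat : ∀ e ∈ atlas E M, ∀ e' ∈ atlas E M,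
    BSmooth (e' ∘ e.symm) (e.target ∩ e.symm ⁻¹' e'.source)

/-- The product atlas, for a product of manifolds modelled on `E` and `F`. -/
instance (priority := low) prodCharted (E F : Type*) [TopologicalSpace E] [TopologicalSpace F]
    (M N : Type*) [TopologicalSpace M] [TopologicalSpace N] [ChartedSpace E M]
    [ChartedSpace F N] : ChartedSpace (E × F) (M × N) :=
  prodChartedSpace E M F N

section Manifold

variable (E E' : Type*) [AddCommGroup E] [Module ℝ E] [TopologicalSpace E]
  [AddCommGroup E'] [Module ℝ E'] [TopologicalSpace E']
  {M N : Type*} [TopologicalSpace M] [TopologicalSpace N] [ChartedSpace E M] [ChartedSpace E' N]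

/-- `f : M → N` is smooth on the open set `U`. -/
def MSmoothOn (f : M → N) (U : Set M) : Prop :=
  ContinuousOn f U ∧ ∀ e ∈ atlas E M, ∀ e' ∈ atlas E' N,
    BSmooth (e' ∘ f ∘ e.symm) (e.target ∩ e.symm ⁻¹' (U ∩ f ⁻¹' e'.source))

/-- `f : M → N` is smooth. -/
def MSmooth (f : M → N) : Prop := MSmoothOn E E' f univ

/-- The tangent map `T_x f : T_x M → T_{f x} N`. As everywhere in Mathlib, the tangent space
`T_x M` is identified with the model space `E` by means of the preferred chart `chartAt E x`. -/
def tangentMap (f : M → N) (x : M) (v : E) : E' :=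
  dirDeriv (chartAt E' (f x) ∘ f ∘ (chartAt E x).symm) (chartAt E x x) v

variable {E}

/-- The tangent vector at `e.symm y` which has the coordinates `v` in the chart `e`. -/
def ofChart (e : OpenPartialHomeomorph M E) (y v : E) : E :=
  dirDeriv (chartAt E (e.symm y) ∘ e.symm) y v

/-- The coordinates, in the chart `e`, of the tangent vector `v` at `x`. -/
def toChart (e : OpenPartialHomeomorph M E) (x : M) (v : E) : E :=
  dirDeriv (e ∘ (chartAt E x).symm) (chartAt E x x) v

variable (E) (M)

/-- Vector fields on `M` (not necessarily smooth). -/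
abbrev VField := M → E

/-- `F`-valued differential `1`-forms on `M` (not necessarily smooth). -/
abbrev OneForm (F : Type*) [AddCommGroup F] [Module ℝ F] := M → E →ₗ[ℝ] F

variable {E M}

/-- The local representative of a vector field in the chart `e`. -/
def VField.rep (X : VField E M) (e : OpenPartialHomeomorph M E) (y : E) : E :=
  toChart e (e.symm y) (X (e.symm y))

def VField.IsSmooth (X : VField E M) : Prop :=
  ∀ e ∈ atlas E M, BSmooth (X.rep e) e.target

/-- The Lie bracket of vector fields, `[X, Y] = DY(X) - DX(Y)` in charts. -/
def VField.bracket (X Y : VField E M) : VField E M := fun x =>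
  let e := chartAt E x
  dirDeriv (Y.rep e) (e x) (X x) - dirDeriv (X.rep e) (e x) (Y x)

section Forms

variable {F : Type*} [AddCommGroup F] [Module ℝ F] [TopologicalSpace F]

/-- The local representative of a `1`-form in the chart `e`. -/
def OneForm.rep (α : OneForm E M F) (e : OpenPartialHomeomorph M E) (y v : E) : F :=
  α (e.symm y) (ofChart e y v)

def OneForm.IsSmooth (α : OneForm E M F) : Prop :=
  ∀ e ∈ atlas E M, BSmooth (fun z : E × E => α.rep e z.1 z.2) (e.target ×ˢ univ)

/-- The exterior derivative of a `1`-form,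
`dα(X, Y) = X(α(Y)) - Y(α(X)) - α([X, Y])`, evaluated on fields which are constant in the
preferred chart at `x`. -/
def OneForm.d (α : OneForm E M F) (x : M) (v w : E) : F :=
  let e := chartAt E x
  dirDeriv (fun y => α.rep e y w) (e x) v - dirDeriv (fun y => α.rep e y v) (e x) w

end Forms

variable (E M)

/-- A (weakly) symplectic form on `M`. -/
structure SymplecticForm where
  toFun : M → E →ₗ[ℝ] E →ₗ[ℝ] ℝ
  alt : ∀ x v, toFun x v v = 0
  smooth : ∀ e ∈ atlas E M,
    BSmooth (fun z : E × E × E =>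
      toFun (e.symm z.1) (ofChart e z.1 z.2.1) (ofChart e z.1 z.2.2)) (e.target ×ˢ univ)
  /-- The exterior derivative of the form vanishes. -/
  closed : ∀ (x : M) (v₀ v₁ v₂ : E),
    let e := chartAt E x
    let r : E → E → E → ℝ := fun v w y => toFun (e.symm y) (ofChart e y v) (ofChart e y w)
    dirDeriv (r v₁ v₂) (e x) v₀ - dirDeriv (r v₀ v₂) (e x) v₁ + dirDeriv (r v₀ v₁) (e x) v₂ = 0
  nondeg : ∀ x v, (∀ w, toFun x v w = 0) → v = 0

end Manifold

/-! ## Lie groups and actions -/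

section Group

variable (EG : Type*) [AddCommGroup EG] [Module ℝ EG] [TopologicalSpace EG]
  (G : Type*) [Group G] [TopologicalSpace G] [ChartedSpace EG G]
  (EM : Type*) [AddCommGroup EM] [Module ℝ EM] [TopologicalSpace EM]
  (M : Type*) [TopologicalSpace M] [ChartedSpace EM M] [MulAction G M]

/-- A Lie group modelled on `EG`. Its Lie algebra is `T_1 G`, i.e. `EG` in the preferred chart
at `1`. -/
class LCLieGroup : Prop extends LCManifold EG G where
  smooth_mul : MSmooth (EG × EG) EG (fun z : G × G => z.1 * z.2)
  smooth_inv : MSmooth EG EG (fun g : G => g⁻¹)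

/-- A smooth left action of `G` on `M`. -/
def IsSmoothAction : Prop :=
  MSmooth (EG × EM) EM (fun z : G × M => z.1 • z.2)

variable {EG}

/-- The left invariant vector field with value `ξ` at the identity. -/
def leftInvariant (ξ : EG) : VField EG G := fun g => tangentMap EG EG (fun h : G => g * h) 1 ξ

/-- The bracket of the Lie algebra of `G`. -/
def lieBr (ξ η : EG) : EG :=
  VField.bracket (leftInvariant G ξ) (leftInvariant G η) 1

variable {G}

/-- The adjoint representation of `G` on its Lie algebra. -/
def adj (g : G) (ξ : EG) : EG := tangentMap EG EG (fun h : G => g * h * g⁻¹) 1 ξ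

variable {M}

/-- The tangent vector `g . X` at `g • x`, for `X` tangent to `M` at `x`. -/
def actT (g : G) (x : M) (X : EM) : EM := tangentMap EM EM (fun y : M => g • y) x X

variable (G)

/-- The value `ξ . x` at `x` of the fundamental vector field of `ξ`. -/
def fund (ξ : EG) (x : M) : EM := tangentMap EG EM (fun g : G => g • x) 1 ξ

end Group

/-! ## Klein pairs and dualities -/

section Klein

variable (EG : Type*) [AddCommGroup EG] [Module ℝ EG] [TopologicalSpace EG]
  (G : Type*) [Group G] [TopologicalSpace G] [ChartedSpace EG G]
  (𝔞 : Type*) [LieRing 𝔞] [LieAlgebra ℝ 𝔞] [TopologicalSpace 𝔞]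
  (𝔤' : Type*) [AddCommGroup 𝔤'] [Module ℝ 𝔤'] [TopologicalSpace 𝔤']

/-- A Klein pair `(𝔞, 𝔤)` with group `G`: the topological Lie algebra `𝔞` contains the Lie
algebra `𝔤` of `G` (via `incl`) as a closed complemented subalgebra, and `G` has a representation
on `𝔞` which restricts to the adjoint representation on `𝔤`. -/
structure KleinPair where
  continuous_bracket : Continuous (fun z : 𝔞 × 𝔞 => ⁅z.1, z.2⁆)
  incl : EG →L[ℝ] 𝔞
  isClosedEmbedding_incl : IsClosedEmbedding incl
  incl_bracket : ∀ ξ η : EG, incl (lieBr G ξ η) = ⁅incl ξ, incl η⁆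
  complemented : (LinearMap.range (incl : EG →ₗ[ℝ] 𝔞)).ClosedComplemented
  Ad : G →* (𝔞 →L[ℝ] 𝔞)
  smooth_Ad : MSmooth (EG × 𝔞) 𝔞 (fun z : G × 𝔞 => Ad z.1 z.2)
  Ad_incl : ∀ (g : G) (ξ : EG), Ad g (incl ξ) = incl (adj g ξ)

/-- A duality of the Lie algebra of `G`: a space `𝔤'` (written `𝔤^*` in the literature) with a
non-degenerate pairing `κ` with the Lie algebra of `G`, for which the coadjoint action exists
on `𝔤'`. -/
structure LieDuality where
  κ : 𝔤' →ₗ[ℝ] EG →ₗ[ℝ] ℝ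
  continuous_κ : Continuous (fun z : 𝔤' × EG => κ z.1 z.2)
  nondeg_left : ∀ μ, (∀ ξ, κ μ ξ = 0) → μ = 0
  nondeg_right : ∀ ξ, (∀ μ, κ μ ξ = 0) → ξ = 0
  /-- The coadjoint action; it is determined by `κ`, because `κ` is non-degenerate. -/
  coAd : G → 𝔤' →ₗ[ℝ] 𝔤'
  κ_coAd : ∀ g μ ξ, κ (coAd g μ) (adj g ξ) = κ μ ξ

variable {EG G 𝔞 𝔤'}

/-- A duality of the Klein pair `(𝔞, 𝔤)`: a `G`-invariant pairing of `𝔤'` with `𝔞` which vanishes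
on `𝔤' × 𝔤`. -/
structure KleinDuality (K : KleinPair EG G 𝔞) (D : LieDuality EG G 𝔤') where
  pair : 𝔤' →ₗ[ℝ] 𝔞 →ₗ[ℝ] ℝ
  continuous_pair : Continuous (fun z : 𝔤' × 𝔞 => pair z.1 z.2)
  invariant : ∀ (g : G) μ ξ, pair (D.coAd g μ) (K.Ad g ξ) = pair μ ξ
  vanish : ∀ μ (ξ : EG), pair μ (K.incl ξ) = 0

end Klein

/-! ## Hamiltonian actions -/

section Hamiltonian

variable {EG : Type*} [AddCommGroup EG] [Module ℝ EG] [TopologicalSpace EG]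
  {G : Type*} [Group G] [TopologicalSpace G] [ChartedSpace EG G]
  {EM : Type*} [AddCommGroup EM] [Module ℝ EM] [TopologicalSpace EM]
  {M : Type*} [TopologicalSpace M] [ChartedSpace EM M] [MulAction G M]
  {𝔤' : Type*} [AddCommGroup 𝔤'] [Module ℝ 𝔤'] [TopologicalSpace 𝔤']

variable (EG G) in
/-- The smooth action of `G` on `M` preserves the symplectic form. -/
structure IsSymplecticAction (ω : SymplecticForm EM M) : Prop where
  smooth : IsSmoothAction EG G EM M
  preserves : ∀ (g : G) (x : M) (X Y : EM),
    ω.toFun (g • x) (actT EM g x X) (actT EM g x Y) = ω.toFun x X Y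

/-- `J` is a momentum map: `ω(ξ . x, X) + κ(T_x J(X), ξ) = 0`. -/
structure IsMomentumMap (D : LieDuality EG G 𝔤') (ω : SymplecticForm EM M) (J : M → 𝔤') :
    Prop where
  smooth : MSmooth EM 𝔤' J
  momentum : ∀ (x : M) (X : EM) (ξ : EG),
    ω.toFun x (fund G EM ξ x) X + D.κ (tangentMap EM 𝔤' J x X) ξ = 0

/-- The non-equivariance cocycle `σ(g) = J(g • x) - Ad^*_{g⁻¹} J(x)`; it does not depend on `x`
if `M` is connected. -/
def cocycle (D : LieDuality EG G 𝔤') (J : M → 𝔤') (g : G) (x : M) : 𝔤' :=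
  J (g • x) - D.coAd g (J x)

end Hamiltonian

/-! ## Cartan geometries -/

section Cartan

variable {EG : Type*} [AddCommGroup EG] [Module ℝ EG] [TopologicalSpace EG]
  {G : Type*} [Group G] [TopologicalSpace G] [ChartedSpace EG G]
  {𝔞 : Type*} [LieRing 𝔞] [LieAlgebra ℝ 𝔞] [TopologicalSpace 𝔞]
  {𝔤' : Type*} [AddCommGroup 𝔤'] [Module ℝ 𝔤'] [TopologicalSpace 𝔤']
  (EP : Type*) [AddCommGroup EP] [Module ℝ EP] [TopologicalSpace EP]
  (P : Type*) [TopologicalSpace P] [ChartedSpace EP P] [MulAction G P]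
  (EB : Type*) [AddCommGroup EB] [Module ℝ EB] [TopologicalSpace EB]
  (B : Type*) [TopologicalSpace B] [ChartedSpace EB B]

variable (EG G) {P B} in
/-- `π : P → B` is a smooth left principal `G`-bundle: it is locally isomorphic, over open
subsets `U` of `B` and `G`-equivariantly, to `G × U → U`. -/
structure IsPrincipalBundle (π : P → B) : Prop where
  smooth_action : IsSmoothAction EG G EP P
  smooth_proj : MSmooth EP EB π
  locally_trivial : ∀ b : B, ∃ (U : Set B) (e : OpenPartialHomeomorph P (G × B)),
    b ∈ U ∧ IsOpen U ∧ e.source = π ⁻¹' U ∧ e.target = univ ×ˢ U ∧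
    MSmoothOn EP (EG × EB) e e.source ∧ MSmoothOn (EG × EB) EP e.symm e.target ∧
    (∀ p ∈ e.source, (e p).2 = π p) ∧
    (∀ (g : G), ∀ p ∈ e.source, g • p ∈ e.source ∧ e (g • p) = (g * (e p).1, (e p).2))

/-- A Cartan geometry on `B` modelled on the Klein pair `K`: a principal `G`-bundle `π : P → B`
with a Cartan connection `θ`. -/
structure CartanGeometry (K : KleinPair EG G 𝔞) where
  π : P → B
  isPrincipal : IsPrincipalBundle EG G EP EB π
  /-- The isomorphisms `θ_p : T_p P → 𝔞`. -/
  iso : P → (EP ≃L[ℝ] 𝔞)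
  smooth_θ : OneForm.IsSmooth (fun p => ((iso p).toLinearEquiv : EP →ₗ[ℝ] 𝔞))
  equivariant : ∀ (g : G) (p : P) (X : EP), iso (g • p) (actT EP g p X) = K.Ad g (iso p X)
  fundamental : ∀ (ξ : EG) (p : P), iso p (fund G EP ξ p) = K.incl ξ

variable {EP P EB B} {K : KleinPair EG G 𝔞}

namespace CartanGeometry

section

variable (C : CartanGeometry EP P EB B K)

/-- The Cartan connection as an `𝔞`-valued `1`-form on `P`. -/
def θ : OneForm EP P 𝔞 := fun p => ((C.iso p).toLinearEquiv : EP →ₗ[ℝ] 𝔞)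

/-- The `2`-form `[θ ∧ θ]`. -/
def wedgeBracket (p : P) (X Y : EP) : 𝔞 := ⁅C.θ p X, C.θ p Y⁆ - ⁅C.θ p Y, C.θ p X⁆

/-- The curvature `Ω = dθ - ½ [θ ∧ θ]`. -/
def Ω (p : P) (X Y : EP) : 𝔞 := C.θ.d p X Y - (1 / 2 : ℝ) • C.wedgeBracket p X Y

/-- The Cartan connection is torsion-free: its curvature takes values in `𝔤`. -/
def TorsionFree : Prop := ∀ (p : P) (X Y : EP), C.Ω p X Y ∈ range K.incl

/-- A `1`-form on `P` is basic: it is horizontal and `G`-invariant. -/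
def IsBasic (α : OneForm EP P ℝ) : Prop :=
  (∀ (p : P) (X : EP), tangentMap EP EB C.π p X = 0 → α p X = 0) ∧
  (∀ (g : G) (p : P) (X : EP), α (g • p) (actT EP g p X) = α p X)

/-- The `1`-form `β` on `B` is induced by `α`, that is, `α = π^* β`. -/
def Induces (α : OneForm EP P ℝ) (β : OneForm EB B ℝ) : Prop :=
  ∀ (p : P) (X : EP), α p X = β (C.π p) (tangentMap EP EB C.π p X)

end

variable (EM : Type*) [AddCommGroup EM] [Module ℝ EM] [TopologicalSpace EM]
  {M : Type*} [TopologicalSpace M] [ChartedSpace EM M] [MulAction G M]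

/-- The data which make the Cartan geometry an orbit through the point `m` of the `G`-manifold
`M`. -/
structure OrbitModel (C : CartanGeometry EP P EB B K) (m : M) where
  χ : P → M
  smooth_χ : MSmooth EP EM χ
  equivariant : ∀ (g : G) (p : P), χ (g • p) = g • χ p
  mem_range : m ∈ range χ
  /-- The stabilizer subalgebra `𝔞_m`. -/
  stab : LieSubalgebra ℝ 𝔞
  /-- The right Lie algebra action `ζ ↦ ζ^*` of `𝔞_m` on `P`. -/
  act : stab →ₗ[ℝ] VField EP P
  smooth_act : ∀ ζ, VField.IsSmooth (act ζ)
  act_bracket : ∀ ζ η, act ⁅ζ, η⁆ = VField.bracket (act ζ) (act η)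
  act_comm : ∀ (g : G) ζ (p : P), actT EP g p (act ζ p) = act ζ (g • p)
  tangent_act : ∀ ζ (p : P), tangentMap EP EM χ p (act ζ p) = 0

namespace OrbitModel

variable {C : CartanGeometry EP P EB B K} {EM} {m : M} (O : C.OrbitModel EM m) (J : M → 𝔤')

/-- The infinitesimal action `ρ_p(ξ) = T_p χ (θ_p⁻¹ ξ)` of `𝔞` along `χ`. -/
def ρ (p : P) (ξ : 𝔞) : EM := tangentMap EP EM O.χ p ((C.iso p).symm ξ)

/-- The Calabi operator `C_p = T_{χ(p)} J ∘ ρ_p`. -/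
def calabi (p : P) (ξ : 𝔞) : 𝔤' := tangentMap EM 𝔤' J (O.χ p) (O.ρ p ξ)

variable {D : LieDuality EG G 𝔤'} (κ : KleinDuality K D)

/-- `𝔞`-equivariance of the momentum map `J` relative to the duality `κ`. -/
structure IsEquivariantMomentum : Prop where
  calabi_eq : ∀ (p : P) (ξ η : 𝔞),
    κ.pair (O.calabi J p ξ) η - κ.pair (O.calabi J p η) ξ = - κ.pair (J (O.χ p)) ⁅ξ, η⁆
  cocycle_eq : ∀ (g : G) (x : M) (ξ : 𝔞), κ.pair (cocycle D J g x) ξ = 0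

/-- The `1`-form `α_p(X) = κ(J(χ(p)), θ_p(X))` on `P`. -/
def kempfNessForm : OneForm EP P ℝ := fun p => (κ.pair (J (O.χ p))).comp (C.θ p)

end OrbitModel

end CartanGeometry

end Cartan

end

end LCGeom

open LCGeom

namespace LCGeom

set_option linter.unusedSectionVars false

universe u v w

/-! The form `α = κ(J ∘ χ, θ)` pairs two equivariant objects. It is horizontal because every
vertical vector is the value of a fundamental field, which `θ` sends into `𝔤`, where `κ` vanishes.
It is `G`-invariant because `θ` and the pairing are equivariant, while the failure `σ` of `J` to be
equivariant is annihilated by `κ` (`kempfNessForm_isBasic`).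

For `dα`, the Leibniz rule gives `κ(J ∘ χ, dθ(X, Y))` plus the antisymmetrisation of `κ(C_p θX,
θY)`. By `𝔞`-equivariance the latter is `-κ(J ∘ χ, [θX, θY])`, which completes `dθ` to the curvature
(`kempfNessForm_d`). If `Ω` is `𝔤`-valued, the pairing kills it.

A basic form descends: local sections of the bundle express the form on `B` as a pullback `s^* α`,
so that smoothness, uniqueness and closedness pass to the base (`Induces.isPullbackOn`,
`IsBasic.exists_induces`). A closed form has local primitives by radial integration
(`exists_primitive_of_convex`). Two of them differ by a locally constant function, so the primitives
form a covering with fibre `ℝ`, which has a global section over a simply connected base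
(`exists_global_of_locally_constant_sub`).

Most of the work is calculus without norms. Everything rests on a mean value theorem for closed
convex sets (`sub_mem_of_hasDirDeriv`), obtained from Hahn–Banach. Together with compactness of `[0,
1]` it shows that a continuous differential is a strict one (`hasStrictDirDeriv_of_continuousOn`),
and strictness yields additivity of the derivative, the chain rule, symmetry of second derivatives
and hence naturality of `d`. -/

instance LocConvex.prod {E F : Type*} [AddCommGroup E] [Module ℝ E] [TopologicalSpace E]
    [AddCommGroup F] [Module ℝ F] [TopologicalSpace F] [LocConvex E] [LocConvex F] :
    LocConvex (E × F) where

instance LocConvex.real : LocConvex ℝ where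

/-! ### Directional derivatives, the mean value theorem and strict differentiability -/

section DirDeriv

variable {E F H : Type*} [AddCommGroup E] [Module ℝ E] [TopologicalSpace E]
  [AddCommGroup F] [Module ℝ F] [TopologicalSpace F]
  [AddCommGroup H] [Module ℝ H] [TopologicalSpace H]

theorem HasDirDeriv.dirDeriv_eq [T2Space F] {f : E → F} {x v : E} {L : F}
    (h : HasDirDeriv f x v L) : dirDeriv f x v = L :=
  h.limUnder_eq

theorem HasDirDeriv.smul_dir [ContinuousConstSMul ℝ F] {f : E → F} {x v : E} {L : F}
    (h : HasDirDeriv f x v L) (c : ℝ) : HasDirDeriv f x (c • v) (c • L) := by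
  unfold HasDirDeriv at *
  -- The substitution `t ↦ t * c` preserves the punctured neighbourhood of `0` only for `c ≠ 0`.
  rcases eq_or_ne c 0 with rfl | hc
  · simpa using tendsto_const_nhds
  have h1 : Tendsto (fun t : ℝ => t * c) (𝓝[≠] 0) (𝓝[≠] 0) := by
    refine tendsto_nhdsWithin_iff.2 ⟨?_, ?_⟩
    · have : Tendsto (fun t : ℝ => t * c) (𝓝 0) (𝓝 (0 * c)) :=
        (continuous_id.mul continuous_const).tendsto _
      rw [zero_mul] at this
      exact this.mono_left nhdsWithin_le_nhds
    · filter_upwards [self_mem_nhdsWithin] with t ht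
      exact mul_ne_zero ht hc
  refine ((h.comp h1).const_smul c).congr fun t => ?_
  simp only [Function.comp_apply, smul_smul, mul_inv]
  congr 1
  field_simp

theorem HasDirDeriv.const_smul [ContinuousConstSMul ℝ F] {f : E → F} {x v : E} {L : F}
    (h : HasDirDeriv f x v L) (c : ℝ) : HasDirDeriv (fun y => c • f y) x v (c • L) := by
  unfold HasDirDeriv at *
  refine (Tendsto.const_smul h c).congr fun t => ?_
  rw [← smul_sub, smul_comm]

theorem HasDirDeriv.clm_comp {f : E → F} {x v : E} {L : F} (h : HasDirDeriv f x v L)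
    (A : F →L[ℝ] H) : HasDirDeriv (fun y => A (f y)) x v (A L) := by
  unfold HasDirDeriv at *
  refine ((A.continuous.tendsto L).comp h).congr fun t => ?_
  simp

theorem HasDirDeriv.hasDerivAt {f : E → ℝ} {x v : E} {s L : ℝ}
    (h : HasDirDeriv f (x + s • v) v L) : HasDerivAt (fun s : ℝ => f (x + s • v)) L s := by
  rw [hasDerivAt_iff_tendsto_slope_zero]
  refine Tendsto.congr (fun t => ?_) h
  rw [add_smul, add_assoc]

theorem hasDirDeriv_iff_hasDerivAt {f : E → ℝ} {x v : E} {L : ℝ} :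
    HasDirDeriv f x v L ↔ HasDerivAt (fun s : ℝ => f (x + s • v)) L 0 := by
  rw [hasDerivAt_iff_tendsto_slope_zero]
  simp [HasDirDeriv]

/-- The mean value theorem in locally convex spaces. -/
theorem sub_mem_of_hasDirDeriv [LocConvex F] {f f' : E → F} {y w : E} {V : Set F}
    (hV : Convex ℝ V) (hVc : IsClosed V)
    (h : ∀ s ∈ Icc (0 : ℝ) 1, HasDirDeriv f (y + s • w) w (f' (y + s • w)))
    (hf' : ∀ s ∈ Icc (0 : ℝ) 1, f' (y + s • w) ∈ V) : f (y + w) - f y ∈ V := by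
  by_contra hn
  -- A functional separating the increment from `V` reduces the claim to the real mean value theorem
  -- along the segment.
  obtain ⟨φ, u, h1, h2⟩ := geometric_hahn_banach_closed_point hV hVc hn
  have hd : ∀ s ∈ Icc (0 : ℝ) 1,
      HasDerivAt (fun s : ℝ => φ (f (y + s • w))) (φ (f' (y + s • w))) s := fun s hs =>
    HasDirDeriv.hasDerivAt (f := fun z => φ (f z)) ((h s hs).clm_comp φ)
  obtain ⟨c, hc, hc'⟩ := exists_hasDerivAt_eq_slope (fun s : ℝ => φ (f (y + s • w)))
    (fun s : ℝ => φ (f' (y + s • w))) zero_lt_one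
    (fun s hs => (hd s hs).continuousAt.continuousWithinAt)
    (fun s hs => hd s (Ioo_subset_Icc_self hs))
  have h3 := h1 _ (hf' c (Ioo_subset_Icc_self hc))
  simp only [one_smul, zero_smul, add_zero, sub_zero, div_one] at hc'
  rw [hc', ← map_sub] at h3
  exact lt_asymm h2 h3

/-- `L` is the strict directional derivative of `f` at `x` in the direction `v`: both the base
point and the direction may vary. -/
def HasStrictDirDeriv (f : E → F) (x v : E) (L : F) : Prop :=
  Tendsto (fun p : (E × E) × ℝ => p.2⁻¹ • (f (p.1.1 + p.2 • p.1.2) - f p.1.1))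
    ((𝓝 x ×ˢ 𝓝 v) ×ˢ 𝓝[≠] 0) (𝓝 L)

theorem HasStrictDirDeriv.tendsto {f : E → F} {x v : E} {L : F} (h : HasStrictDirDeriv f x v L)
    {ι : Type*} {l : Filter ι} {a b : ι → E} {t : ι → ℝ} (ha : Tendsto a l (𝓝 x))
    (hb : Tendsto b l (𝓝 v)) (ht : Tendsto t l (𝓝[≠] 0)) :
    Tendsto (fun i => (t i)⁻¹ • (f (a i + t i • b i) - f (a i))) l (𝓝 L) :=
  Tendsto.comp h ((ha.prodMk hb).prodMk ht)

theorem HasStrictDirDeriv.hasDirDeriv {f : E → F} {x v : E} {L : F}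
    (h : HasStrictDirDeriv f x v L) : HasDirDeriv f x v L :=
  h.tendsto tendsto_const_nhds tendsto_const_nhds tendsto_id

theorem tendsto_add_smul [ContinuousAdd E] [ContinuousSMul ℝ E] {x v : E}
    {ι : Type*} {l : Filter ι} {a b : ι → E} {t : ι → ℝ} (ha : Tendsto a l (𝓝 x))
    (hb : Tendsto b l (𝓝 v)) (ht : Tendsto t l (𝓝[≠] 0)) :
    Tendsto (fun i => a i + t i • b i) l (𝓝 x) := by
  have := ha.add ((ht.mono_right nhdsWithin_le_nhds).smul hb)
  rwa [zero_smul, add_zero] at this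

theorem HasDirDeriv.congr_of_eventuallyEq [ContinuousAdd E] [ContinuousSMul ℝ E]
    {f g : E → F} {x v : E} {L : F} (h : HasDirDeriv f x v L) (hfg : f =ᶠ[𝓝 x] g) :
    HasDirDeriv g x v L := by
  unfold HasDirDeriv at *
  have h1 : Tendsto (fun t : ℝ => x + t • v) (𝓝[≠] 0) (𝓝 x) :=
    tendsto_add_smul tendsto_const_nhds tendsto_const_nhds tendsto_id
  refine h.congr' ?_
  filter_upwards [h1.eventually hfg] with t ht
  rw [ht, hfg.eq_of_nhds]

/-- No differentiability is needed: the two difference quotients agree eventually, so even the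
default values of `limUnder` coincide. -/
theorem dirDeriv_congr [ContinuousAdd E] [ContinuousSMul ℝ E]
    {f g : E → F} {x : E} (hfg : f =ᶠ[𝓝 x] g) (v : E) : dirDeriv f x v = dirDeriv g x v := by
  have h1 : Tendsto (fun t : ℝ => x + t • v) (𝓝[≠] 0) (𝓝 x) :=
    tendsto_add_smul tendsto_const_nhds tendsto_const_nhds tendsto_id
  unfold dirDeriv limUnder
  congr 1
  refine map_congr ?_
  filter_upwards [h1.eventually hfg] with t ht
  rw [ht, hfg.eq_of_nhds]

theorem HasStrictDirDeriv.congr_of_eventuallyEq [ContinuousAdd E] [ContinuousSMul ℝ E]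
    {f g : E → F} {x v : E} {L : F} (h : HasStrictDirDeriv f x v L) (hfg : f =ᶠ[𝓝 x] g) :
    HasStrictDirDeriv g x v L := by
  unfold HasStrictDirDeriv at *
  have h0 : Tendsto (fun p : (E × E) × ℝ => p.1.1) ((𝓝 x ×ˢ 𝓝 v) ×ˢ 𝓝[≠] 0) (𝓝 x) :=
    tendsto_fst.comp tendsto_fst
  have h1 : Tendsto (fun p : (E × E) × ℝ => p.1.1 + p.2 • p.1.2)
      ((𝓝 x ×ˢ 𝓝 v) ×ˢ 𝓝[≠] 0) (𝓝 x) :=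
    tendsto_add_smul h0 (tendsto_snd.comp tendsto_fst) tendsto_snd
  refine h.congr' ?_
  filter_upwards [h1.eventually hfg, h0.eventually hfg] with p hp hp'
  rw [hp, hp']

/-- The increment of `f` is `t` times its own difference quotient. Thus the quotient for `g ∘ f` is
one for `g` with moving base point and moving direction, which is what strictness allows. -/
theorem HasStrictDirDeriv.comp [ContinuousAdd E] [ContinuousSMul ℝ E] {g : F → H} {f : E → F}
    {x v : E} {L : F} {L' : H}
    (hg : HasStrictDirDeriv g (f x) L L') (hf : HasStrictDirDeriv f x v L)
    (hc : ContinuousAt f x) : HasStrictDirDeriv (fun y => g (f y)) x v L' := by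
  unfold HasStrictDirDeriv at hf
  have h0 : Tendsto (fun p : (E × E) × ℝ => f p.1.1) ((𝓝 x ×ˢ 𝓝 v) ×ˢ 𝓝[≠] 0) (𝓝 (f x)) :=
    Tendsto.comp (y := 𝓝 x) hc (tendsto_fst.comp tendsto_fst)
  have h1 : Tendsto (fun p : (E × E) × ℝ => p.2) ((𝓝 x ×ˢ 𝓝 v) ×ˢ 𝓝[≠] 0) (𝓝[≠] 0) :=
    tendsto_snd
  refine (hg.tendsto h0 hf h1).congr' ?_
  filter_upwards [h1.eventually self_mem_nhdsWithin] with p hp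
  rw [smul_inv_smul₀ hp, add_sub_cancel]

/-- A function with a continuous directional derivative is strictly differentiable. -/
theorem hasStrictDirDeriv_of_continuousOn [LocConvex E] [LocConvex F] {f : E → F} {f' : E × E → F}
    {U : Set E} (hU : IsOpen U) (h : ∀ x ∈ U, ∀ v, HasDirDeriv f x v (f' (x, v)))
    (hf' : ContinuousOn f' (U ×ˢ univ)) {x : E} (hx : x ∈ U) (v : E) :
    HasStrictDirDeriv f x v (f' (x, v)) := by
  have key : ∀ V : Set F, V ∈ 𝓝 (f' (x, v)) → IsClosed V → Convex ℝ V →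
      ∀ᶠ p : (E × E) × ℝ in (𝓝 x ×ˢ 𝓝 v) ×ˢ 𝓝[≠] 0,
        p.2⁻¹ • (f (p.1.1 + p.2 • p.1.2) - f p.1.1) ∈ V := by
    intro V hV hVc hVx
    -- Nearness to `f' (x, v)` holds at each `s` separately; compactness of `[0, 1]` makes it
    -- uniform along the segment.
    have hc : ∀ s ∈ Icc (0 : ℝ) 1, ∀ᶠ z : ((E × E) × ℝ) × ℝ in 𝓝 (((x, v), (0 : ℝ)), s),
        (z.1.1.1 + (z.2 * z.1.2) • z.1.1.2 ∈ U ∧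
          f' (z.1.1.1 + (z.2 * z.1.2) • z.1.1.2, z.1.1.2) ∈ V) := by
      intro s _
      have h1 : Tendsto (fun z : ((E × E) × ℝ) × ℝ =>
          (z.1.1.1 + (z.2 * z.1.2) • z.1.1.2, z.1.1.2)) (𝓝 (((x, v), (0 : ℝ)), s))
          (𝓝 (x, v)) := by
        have : Continuous (fun z : ((E × E) × ℝ) × ℝ =>
          (z.1.1.1 + (z.2 * z.1.2) • z.1.1.2, z.1.1.2)) := by fun_prop
        simpa using this.tendsto (((x, v), (0 : ℝ)), s)
      have h2 : U ×ˢ (univ : Set E) ∈ 𝓝 (x, v) :=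
        (hU.prod isOpen_univ).mem_nhds ⟨hx, mem_univ _⟩
      filter_upwards [h1.eventually h2, h1.eventually ((hf'.continuousAt h2) hV)] with z h3 h4
      exact ⟨h3.1, h4⟩
    have := isCompact_Icc.eventually_forall_of_forall_eventually
      (P := fun (p : (E × E) × ℝ) (s : ℝ) => (p.1.1 + (s * p.2) • p.1.2 ∈ U ∧
          f' (p.1.1 + (s * p.2) • p.1.2, p.1.2) ∈ V)) hc
    rw [nhds_prod_eq, nhds_prod_eq] at this
    have h5 : (𝓝 x ×ˢ 𝓝 v) ×ˢ 𝓝[≠] (0 : ℝ) ≤ (𝓝 x ×ˢ 𝓝 v) ×ˢ 𝓝 (0 : ℝ) :=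
      Filter.prod_mono le_rfl nhdsWithin_le_nhds
    filter_upwards [h5 this, tendsto_snd.eventually self_mem_nhdsWithin] with p hp hp0
    have hp0 : p.2 ≠ 0 := hp0
    -- Rescaling `f` by `t⁻¹` cancels the factor `t` of the direction, so the derivative along the
    -- segment is a value of `f'`.
    have := sub_mem_of_hasDirDeriv (f := fun z => p.2⁻¹ • f z) (f' := fun z => f' (z, p.1.2))
      (y := p.1.1) (w := p.2 • p.1.2) hVx hVc ?_ ?_
    · simpa only [smul_sub] using this
    · intro s hs
      have h6 := ((h _ (hp s hs).1 p.1.2).smul_dir p.2).const_smul p.2⁻¹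
      rw [inv_smul_smul₀ hp0] at h6
      rw [smul_smul]
      exact h6
    · intro s hs
      rw [smul_smul]
      exact (hp s hs).2
  intro W hW
  -- Closed convex neighbourhoods form a basis: take the closure of a convex neighbourhood inside a
  -- closed one.
  obtain ⟨V', ⟨hV', hVc'⟩, hVW'⟩ := (closed_nhds_basis (f' (x, v))).mem_iff.1 hW
  obtain ⟨V'', ⟨hV'', hVx''⟩, hVW''⟩ :=
    (LocallyConvexSpace.convex_basis (𝕜 := ℝ) (f' (x, v))).mem_iff.1 hV'
  have := key (closure V'') (mem_of_superset hV'' subset_closure) isClosed_closure hVx''.closure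
  filter_upwards [this] with p hp
  exact hVW' (closure_minimal hVW'' hVc' hp)

/-- Strict differentiability (in all directions) at a point. -/
def SDiffAt (f : E → F) (x : E) : Prop :=
  ContinuousAt f x ∧ ∀ v, HasStrictDirDeriv f x v (dirDeriv f x v)

theorem SDiffAt.hasDirDeriv {f : E → F} {x : E} (h : SDiffAt f x) (v : E) :
    HasDirDeriv f x v (dirDeriv f x v) :=
  (h.2 v).hasDirDeriv

theorem SDiffAt.congr [ContinuousAdd E] [ContinuousSMul ℝ E] {f g : E → F} {x : E}
    (h : SDiffAt f x) (hfg : f =ᶠ[𝓝 x] g) : SDiffAt g x :=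
  ⟨h.1.congr hfg, fun v => by
    rw [← dirDeriv_congr hfg]
    exact (h.2 v).congr_of_eventuallyEq hfg⟩

theorem SDiffAt.dirDeriv_comp [ContinuousAdd E] [ContinuousSMul ℝ E] [T2Space H]
    {g : F → H} {f : E → F} {x : E} (hg : SDiffAt g (f x)) (hf : SDiffAt f x) (v : E) :
    dirDeriv (fun y => g (f y)) x v = dirDeriv g (f x) (dirDeriv f x v) :=
  ((hg.2 _).comp (hf.2 v) hf.1).hasDirDeriv.dirDeriv_eq

theorem SDiffAt.comp [ContinuousAdd E] [ContinuousSMul ℝ E] [T2Space H]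
    {g : F → H} {f : E → F} {x : E} (hg : SDiffAt g (f x)) (hf : SDiffAt f x) :
    SDiffAt (fun y => g (f y)) x :=
  ⟨ContinuousAt.comp (g := g) hg.1 hf.1, fun v => by
    rw [hg.dirDeriv_comp hf]
    exact (hg.2 _).comp (hf.2 v) hf.1⟩

/-- The increment is split at `x + t • v`. The second piece starts from a moving base point, so
strictness is used. -/
theorem SDiffAt.dirDeriv_add [LocConvex E] [LocConvex F] {f : E → F} {x : E}
    (hf : SDiffAt f x) (v w : E) : dirDeriv f x (v + w) = dirDeriv f x v + dirDeriv f x w := by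
  refine HasDirDeriv.dirDeriv_eq ?_
  have h0 : Tendsto (fun t : ℝ => x + t • v) (𝓝[≠] 0) (𝓝 x) :=
    tendsto_add_smul tendsto_const_nhds tendsto_const_nhds tendsto_id
  have h1 := (hf.2 w).tendsto h0 (tendsto_const_nhds (x := w)) tendsto_id
  refine ((hf.hasDirDeriv v).add h1).congr fun t => ?_
  simp only [id]
  rw [← smul_add]
  congr 1
  simp only [smul_add, add_assoc]
  abel

theorem SDiffAt.dirDeriv_smul [LocConvex F] {f : E → F} {x : E}
    (hf : SDiffAt f x) (c : ℝ) (v : E) : dirDeriv f x (c • v) = c • dirDeriv f x v :=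
  ((hf.hasDirDeriv v).smul_dir c).dirDeriv_eq

theorem dirDeriv_clm [T2Space F] (A : E →L[ℝ] F) (x v : E) : dirDeriv A x v = A v := by
  refine HasDirDeriv.dirDeriv_eq ?_
  refine (tendsto_const_nhds (x := A v)).congr' ?_
  filter_upwards [self_mem_nhdsWithin] with t ht
  have ht : t ≠ 0 := ht
  simp [smul_smul, ht]

theorem sDiffAt_clm [T2Space F] (A : E →L[ℝ] F) (x : E) : SDiffAt A x := by
  refine ⟨A.continuous.continuousAt, fun v => ?_⟩
  rw [dirDeriv_clm]
  have : Tendsto (fun p : (E × E) × ℝ => A p.1.2) ((𝓝 x ×ˢ 𝓝 v) ×ˢ 𝓝[≠] 0) (𝓝 (A v)) :=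
    (A.continuous.tendsto v).comp (tendsto_snd.comp tendsto_fst)
  refine this.congr' ?_
  filter_upwards [tendsto_snd.eventually self_mem_nhdsWithin] with p hp
  have hp : p.2 ≠ 0 := hp
  simp [smul_smul, hp]

end DirDeriv

/-! ### Calculus of `C^n` and smooth maps on open sets -/

section Bastiani

variable {E : Type u} [AddCommGroup E] [Module ℝ E] [TopologicalSpace E]
  {F : Type v} [AddCommGroup F] [Module ℝ F] [TopologicalSpace F]
  {H : Type w} [AddCommGroup H] [Module ℝ H] [TopologicalSpace H]

theorem BastianiC.continuousOn {n : ℕ} {f : E → F} {U : Set E} (h : BastianiC n f U) :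
    ContinuousOn f U := by
  cases n with
  | zero => exact h
  | succ n => exact h.1

theorem BastianiC.mono {n : ℕ} {f : E → F} {U V : Set E} (h : BastianiC n f V) (hUV : U ⊆ V) :
    BastianiC n f U := by
  induction n generalizing E with
  | zero => exact ContinuousOn.mono h hUV
  | succ n ih =>
    obtain ⟨hc, f', hf', hn⟩ := h
    exact ⟨hc.mono hUV, f', fun x hx => hf' x (hUV hx), ih hn (prod_mono hUV le_rfl)⟩

theorem BastianiC.of_succ {n : ℕ} {f : E → F} {U : Set E} (h : BastianiC (n + 1) f U) :
    BastianiC n f U := by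
  induction n generalizing E with
  | zero => exact h.1
  | succ n ih =>
    obtain ⟨hc, f', hf', hn⟩ := h
    exact ⟨hc, f', hf', ih hn⟩

theorem BastianiC.congr [LocConvex E] {n : ℕ} {f g : E → F} {U : Set E} (h : BastianiC n f U)
    (hU : IsOpen U) (hfg : EqOn f g U) : BastianiC n g U := by
  cases n with
  | zero => exact ContinuousOn.congr h hfg.symm
  | succ n =>
    obtain ⟨hc, f', hf', hn⟩ := h
    exact ⟨hc.congr hfg.symm, f', fun x hx v =>
      (hf' x hx v).congr_of_eventuallyEq (hfg.eventuallyEq_of_mem (hU.mem_nhds hx)), hn⟩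

theorem BastianiC.comp_clm {n : ℕ} {f : F → H} {U : Set F} (h : BastianiC n f U)
    (A : E →L[ℝ] F) : BastianiC n (fun x => f (A x)) (A ⁻¹' U) := by
  induction n generalizing E F with
  | zero => exact ContinuousOn.comp h A.continuous.continuousOn (mapsTo_preimage _ _)
  | succ n ih =>
    obtain ⟨hc, f', hf', hn⟩ := h
    refine ⟨hc.comp A.continuous.continuousOn (mapsTo_preimage _ _),
      fun z => f' (A.prodMap A z), fun x hx v => ?_, (ih hn (A.prodMap A)).mono ?_⟩
    · have := hf' (A x) hx (A v)
      unfold HasDirDeriv at *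
      simpa using this
    · rintro ⟨x, v⟩ ⟨hx, -⟩
      exact ⟨hx, mem_univ _⟩

theorem BastianiC.prodMk {n : ℕ} {f : E → F} {g : E → H} {U : Set E} (hf : BastianiC n f U)
    (hg : BastianiC n g U) : BastianiC n (fun x => (f x, g x)) U := by
  induction n generalizing E with
  | zero => exact ContinuousOn.prodMk hf hg
  | succ n ih =>
    obtain ⟨hc, f', hf', hn⟩ := hf
    obtain ⟨hd, g', hg', hm⟩ := hg
    exact ⟨hc.prodMk hd, fun z => (f' z, g' z),
      fun x hx v => (hf' x hx v).prodMk_nhds (hg' x hx v), ih hn hm⟩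

theorem bastianiC_const (n : ℕ) (c : F) (U : Set E) : BastianiC n (fun _ => c) U := by
  induction n generalizing E c with
  | zero => exact continuousOn_const
  | succ n ih =>
    refine ⟨continuousOn_const, fun _ => 0, fun x _ v => ?_, ih 0 _⟩
    simpa [HasDirDeriv] using tendsto_const_nhds

theorem bastianiC_clm (n : ℕ) (A : E →L[ℝ] F) (U : Set E) : BastianiC n A U := by
  induction n generalizing E with
  | zero => exact A.continuous.continuousOn
  | succ n ih =>
    refine ⟨A.continuous.continuousOn, fun z => (A.comp (ContinuousLinearMap.snd ℝ E E)) z,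
      fun x _ v => ?_, ih _ _⟩
    refine (tendsto_const_nhds (x := A v)).congr' ?_
    filter_upwards [self_mem_nhdsWithin] with t ht
    have ht : t ≠ 0 := ht
    simp [smul_smul, ht]

/-- The differential of `g ∘ f` is `g'` composed with `(f ∘ fst, f')`, again a composition of `C^n`
maps, but between the doubled spaces; hence the induction over all `E` and `F`. -/
theorem BastianiC.comp [LocConvex E] [LocConvex F] [LocConvex H] {n : ℕ} {f : E → F} {g : F → H}
    {U : Set E} {V : Set F} (hg : BastianiC n g V) (hf : BastianiC n f U) (hU : IsOpen U)
    (hV : IsOpen V) (hUV : MapsTo f U V) : BastianiC n (fun x => g (f x)) U := by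
  induction n generalizing E F with
  | zero => exact ContinuousOn.comp hg hf hUV
  | succ n ih =>
    have hf1 := hf.of_succ
    obtain ⟨hc, f', hf', hn⟩ := hf
    obtain ⟨hd, g', hg', hm⟩ := hg
    refine ⟨hd.comp hc hUV, fun z => g' (f z.1, f' z), fun x hx v => ?_, ?_⟩
    · exact ((hasStrictDirDeriv_of_continuousOn hV hg' hm.continuousOn (hUV hx) _).comp
        (hasStrictDirDeriv_of_continuousOn hU hf' hn.continuousOn hx v)
        (hc.continuousAt (hU.mem_nhds hx))).hasDirDeriv
    · refine ih (f := fun z => (f z.1, f' z)) hm (BastianiC.prodMk ?_ hn) (hU.prod isOpen_univ)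
        (hV.prod isOpen_univ) fun z hz => ⟨hUV hz.1, mem_univ _⟩
      exact (hf1.comp_clm (ContinuousLinearMap.fst ℝ E E)).mono fun z hz => hz.1

/-- In a Hausdorff space the differential is forced to be `dirDeriv`. Removing the existential makes
the `C^n` property local. -/
theorem bastianiC_succ_iff [LocConvex E] [LocConvex F] {n : ℕ} {f : E → F} {U : Set E}
    (hU : IsOpen U) : BastianiC (n + 1) f U ↔ ContinuousOn f U ∧
      (∀ x ∈ U, ∀ v, HasDirDeriv f x v (dirDeriv f x v)) ∧
      BastianiC n (fun z : E × E => dirDeriv f z.1 z.2) (U ×ˢ univ) := by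
  constructor
  · rintro ⟨hc, f', hf', hn⟩
    have h1 : ∀ x ∈ U, ∀ v, dirDeriv f x v = f' (x, v) := fun x hx v => (hf' x hx v).dirDeriv_eq
    refine ⟨hc, fun x hx v => ?_, hn.congr (hU.prod isOpen_univ) fun z hz => ?_⟩
    · rw [h1 x hx v]
      exact hf' x hx v
    · exact (h1 z.1 hz.1 z.2).symm
  · rintro ⟨hc, hd, hn⟩
    exact ⟨hc, _, hd, hn⟩

theorem bastianiC_of_locally [LocConvex E] [LocConvex F] {n : ℕ} {f : E → F} {U : Set E}
    (hU : IsOpen U) (h : ∀ x ∈ U, ∃ V, IsOpen V ∧ x ∈ V ∧ BastianiC n f (U ∩ V)) :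
    BastianiC n f U := by
  induction n generalizing E with
  | zero =>
    intro x hx
    obtain ⟨V, hV, hxV, hn⟩ := h x hx
    exact ((ContinuousOn.continuousAt hn
      ((hU.inter hV).mem_nhds ⟨hx, hxV⟩))).continuousWithinAt
  | succ n ih =>
    rw [bastianiC_succ_iff hU]
    refine ⟨fun x hx => ?_, fun x hx v => ?_, ih (hU.prod isOpen_univ) fun z hz => ?_⟩
    · obtain ⟨V, hV, hxV, hn⟩ := h x hx
      exact (hn.continuousOn.continuousAt ((hU.inter hV).mem_nhds ⟨hx, hxV⟩)).continuousWithinAt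
    · obtain ⟨V, hV, hxV, hn⟩ := h x hx
      exact ((bastianiC_succ_iff (hU.inter hV)).1 hn).2.1 x ⟨hx, hxV⟩ v
    · obtain ⟨V, hV, hxV, hn⟩ := h z.1 hz.1
      exact ⟨V ×ˢ univ, hV.prod isOpen_univ, ⟨hxV, mem_univ _⟩,
        ((bastianiC_succ_iff (hU.inter hV)).1 hn).2.2.mono fun y hy => ⟨⟨hy.1.1, hy.2.1⟩, hy.1.2⟩⟩

theorem BSmooth.continuousOn {f : E → F} {U : Set E} (h : BSmooth f U) : ContinuousOn f U :=
  h 0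

theorem BSmooth.mono {f : E → F} {U V : Set E} (h : BSmooth f V) (hUV : U ⊆ V) : BSmooth f U :=
  fun n => (h n).mono hUV

theorem BSmooth.congr [LocConvex E] {f g : E → F} {U : Set E} (h : BSmooth f U)
    (hU : IsOpen U) (hfg : EqOn f g U) : BSmooth g U :=
  fun n => (h n).congr hU hfg

theorem BSmooth.comp [LocConvex E] [LocConvex F] [LocConvex H] {f : E → F} {g : F → H}
    {U : Set E} {V : Set F} (hg : BSmooth g V) (hf : BSmooth f U) (hU : IsOpen U)
    (hV : IsOpen V) (hUV : MapsTo f U V) : BSmooth (fun x => g (f x)) U :=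
  fun n => (hg n).comp (hf n) hU hV hUV

theorem BSmooth.comp_clm {f : F → H} {U : Set F} (h : BSmooth f U) (A : E →L[ℝ] F) :
    BSmooth (fun x => f (A x)) (A ⁻¹' U) :=
  fun n => (h n).comp_clm A

theorem BSmooth.prodMk {f : E → F} {g : E → H} {U : Set E} (hf : BSmooth f U)
    (hg : BSmooth g U) : BSmooth (fun x => (f x, g x)) U :=
  fun n => (hf n).prodMk (hg n)

theorem bSmooth_const (c : F) (U : Set E) : BSmooth (fun _ => c) U :=
  fun n => bastianiC_const n c U

theorem bSmooth_clm (A : E →L[ℝ] F) (U : Set E) : BSmooth A U :=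
  fun n => bastianiC_clm n A U

theorem bSmooth_id (U : Set E) : BSmooth (fun x => x) U :=
  bSmooth_clm (ContinuousLinearMap.id ℝ E) U

theorem BSmooth.fst_prod {f : E → F} {U : Set E} (h : BSmooth f U) :
    BSmooth (fun z : E × E => f z.1) (U ×ˢ univ) :=
  (h.comp_clm (ContinuousLinearMap.fst ℝ E E)).mono fun _ hz => hz.1

theorem bSmooth_of_locally [LocConvex E] [LocConvex F] {f : E → F} {U : Set E}
    (hU : IsOpen U) (h : ∀ x ∈ U, ∃ V, IsOpen V ∧ x ∈ V ∧ BSmooth f (U ∩ V)) :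
    BSmooth f U := fun n => bastianiC_of_locally hU fun x hx =>
  let ⟨V, hV, hxV, hn⟩ := h x hx
  ⟨V, hV, hxV, hn n⟩

theorem BSmooth.hasDirDeriv [LocConvex E] [LocConvex F] {f : E → F} {U : Set E} (h : BSmooth f U)
    (hU : IsOpen U) {x : E} (hx : x ∈ U) (v : E) : HasDirDeriv f x v (dirDeriv f x v) :=
  ((bastianiC_succ_iff hU).1 (h 1)).2.1 x hx v

theorem BSmooth.dirDeriv [LocConvex E] [LocConvex F] {f : E → F} {U : Set E} (h : BSmooth f U)
    (hU : IsOpen U) : BSmooth (fun z : E × E => dirDeriv f z.1 z.2) (U ×ˢ univ) :=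
  fun n => ((bastianiC_succ_iff hU).1 (h (n + 1))).2.2

theorem BSmooth.sDiffAt [LocConvex E] [LocConvex F] {f : E → F} {U : Set E} (h : BSmooth f U)
    (hU : IsOpen U) {x : E} (hx : x ∈ U) : SDiffAt f x :=
  ⟨h.continuousOn.continuousAt (hU.mem_nhds hx), fun v =>
    hasStrictDirDeriv_of_continuousOn (f' := fun z => LCGeom.dirDeriv f z.1 z.2) hU
      (fun _ hy => h.hasDirDeriv hU hy) (h.dirDeriv hU).continuousOn hx v⟩

theorem bSmooth_of_hasDirDeriv [LocConvex E] [LocConvex F] {f : E → F} {f' : E × E → F}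
    {U : Set E} (hc : ContinuousOn f U)
    (hf : ∀ x ∈ U, ∀ v, HasDirDeriv f x v (f' (x, v))) (hf' : BSmooth f' (U ×ˢ univ)) :
    BSmooth f U := by
  rintro (_ | n)
  · exact hc
  · exact ⟨hc, f', hf, hf' n⟩

theorem bSmooth_add [LocConvex F] (U : Set (F × F)) : BSmooth (fun z : F × F => z.1 + z.2) U :=
  bSmooth_clm (ContinuousLinearMap.fst ℝ F F + ContinuousLinearMap.snd ℝ F F) U

theorem BSmooth.add [LocConvex E] [LocConvex F] {f g : E → F} {U : Set E} (hU : IsOpen U)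
    (hf : BSmooth f U) (hg : BSmooth g U) : BSmooth (fun x => f x + g x) U :=
  (bSmooth_add univ).comp (hf.prodMk hg) hU isOpen_univ (mapsTo_univ _ _)

theorem hasDirDeriv_bilinear [LocConvex E] [LocConvex F] [LocConvex H] (b : E →ₗ[ℝ] F →ₗ[ℝ] H)
    (z w : E × F) :
    HasDirDeriv (fun z : E × F => b z.1 z.2) z w (b z.1 w.2 + b w.1 z.2) := by
  have h1 : Tendsto (fun t : ℝ => (b z.1 w.2 + b w.1 z.2) + t • b w.1 w.2) (𝓝[≠] 0)
      (𝓝 (b z.1 w.2 + b w.1 z.2)) :=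
    tendsto_add_smul tendsto_const_nhds tendsto_const_nhds tendsto_id
  refine h1.congr' ?_
  filter_upwards [self_mem_nhdsWithin] with t ht
  have ht : t ≠ 0 := ht
  simp only [Prod.fst_add, Prod.snd_add, Prod.smul_fst, Prod.smul_snd, map_add, map_smul,
    LinearMap.add_apply, LinearMap.smul_apply]
  rw [eq_inv_smul_iff₀ ht]
  simp only [smul_add, smul_smul]
  abel

/-- The differential is a sum of two copies of `b` precomposed with continuous linear maps, so `C^n`
implies `C^(n+1)`. -/
theorem bSmooth_bilinear [LocConvex E] [LocConvex F] [LocConvex H] {b : E →ₗ[ℝ] F →ₗ[ℝ] H}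
    (hb : Continuous fun z : E × F => b z.1 z.2) (U : Set (E × F)) :
    BSmooth (fun z : E × F => b z.1 z.2) U := by
  suffices h : ∀ n, BastianiC n (fun z : E × F => b z.1 z.2) univ from
    fun n => (h n).mono (subset_univ _)
  intro n
  induction n with
  | zero => exact hb.continuousOn
  | succ n ih =>
    refine ⟨hb.continuousOn, fun p => b p.1.1 p.2.2 + b p.2.1 p.1.2,
      fun z _ w => hasDirDeriv_bilinear b z w, ?_⟩
    let A : (E × F) × (E × F) →L[ℝ] E × F :=
      ((ContinuousLinearMap.fst ℝ E F).comp (ContinuousLinearMap.fst ℝ (E × F) (E × F))).prod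
      ((ContinuousLinearMap.snd ℝ E F).comp (ContinuousLinearMap.snd ℝ (E × F) (E × F)))
    let A' : (E × F) × (E × F) →L[ℝ] E × F :=
      ((ContinuousLinearMap.fst ℝ E F).comp (ContinuousLinearMap.snd ℝ (E × F) (E × F))).prod
      ((ContinuousLinearMap.snd ℝ E F).comp (ContinuousLinearMap.fst ℝ (E × F) (E × F)))
    have := BastianiC.comp ((bSmooth_add (F := H) univ) n)
      ((ih.comp_clm A).prodMk (ih.comp_clm A')) isOpen_univ isOpen_univ (mapsTo_univ _ _)
    exact this.mono (subset_univ _)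

end Bastiani

/-! ### Tangent maps, smooth maps and charts -/

section Manifold

variable (E E' E'' : Type*) [AddCommGroup E] [Module ℝ E] [TopologicalSpace E] [LocConvex E]
  [AddCommGroup E'] [Module ℝ E'] [TopologicalSpace E'] [LocConvex E']
  [AddCommGroup E''] [Module ℝ E''] [TopologicalSpace E''] [LocConvex E'']
  {M N Q : Type*} [TopologicalSpace M] [TopologicalSpace N] [TopologicalSpace Q]
  [ChartedSpace E M] [ChartedSpace E' N] [ChartedSpace E'' Q]

/-- `f` is strictly differentiable at `x` in the preferred charts. -/
def LCDiffAt (f : M → N) (x : M) : Prop :=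
  ContinuousAt f x ∧ SDiffAt (chartAt E' (f x) ∘ f ∘ (chartAt E x).symm) (chartAt E x x)

variable {E E' E''}

theorem tendsto_chartAt_symm (x : M) :
    Tendsto (chartAt E x).symm (𝓝 (chartAt E x x)) (𝓝 x) := by
  have := (chartAt E x).continuousAt_symm ((chartAt E x).map_source (mem_chart_source E x))
  rwa [ContinuousAt, (chartAt E x).left_inv (mem_chart_source E x)] at this

theorem chart_rep_comp_eventuallyEq {f : M → N} {g : N → Q} {x : M} (hf : ContinuousAt f x) :
    (chartAt E'' (g (f x)) ∘ (fun y => g (f y)) ∘ (chartAt E x).symm) =ᶠ[𝓝 (chartAt E x x)]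
      fun y => (chartAt E'' (g (f x)) ∘ g ∘ (chartAt E' (f x)).symm)
        ((chartAt E' (f x) ∘ f ∘ (chartAt E x).symm) y) := by
  have h1 : Tendsto (fun y => f ((chartAt E x).symm y)) (𝓝 (chartAt E x x)) (𝓝 (f x)) :=
    Tendsto.comp (y := 𝓝 x) hf (tendsto_chartAt_symm x)
  filter_upwards [h1.eventually ((chartAt E' (f x)).open_source.mem_nhds (mem_chart_source E' _))]
    with y hy
  simp only [Function.comp_apply]
  rw [(chartAt E' (f x)).left_inv hy]

theorem chart_rep_apply (f : M → N) (x : M) :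
    (chartAt E' (f x) ∘ f ∘ (chartAt E x).symm) (chartAt E x x) = chartAt E' (f x) (f x) := by
  simp only [Function.comp_apply]
  rw [(chartAt E x).left_inv (mem_chart_source E x)]

theorem LCDiffAt.tangentMap_comp {f : M → N} {g : N → Q} {x : M}
    (hg : LCDiffAt E' E'' g (f x)) (hf : LCDiffAt E E' f x) (v : E) :
    tangentMap E E'' (fun y => g (f y)) x v =
      tangentMap E' E'' g (f x) (tangentMap E E' f x v) := by
  unfold tangentMap
  rw [dirDeriv_congr (chart_rep_comp_eventuallyEq (E' := E') hf.1)]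
  have := hg.2
  rw [← chart_rep_apply (E := E) f x] at this
  rw [this.dirDeriv_comp hf.2, chart_rep_apply]

theorem LCDiffAt.comp {f : M → N} {g : N → Q} {x : M}
    (hg : LCDiffAt E' E'' g (f x)) (hf : LCDiffAt E E' f x) :
    LCDiffAt E E'' (fun y => g (f y)) x := by
  refine ⟨ContinuousAt.comp (g := g) hg.1 hf.1,
    SDiffAt.congr ?_ (chart_rep_comp_eventuallyEq (E' := E') hf.1).symm⟩
  have := hg.2
  rw [← chart_rep_apply (E := E) f x] at this
  exact this.comp hf.2

theorem tangentMap_congr {f g : M → N} {x : M} (h : f =ᶠ[𝓝 x] g) (v : E) :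
    tangentMap E E' f x v = tangentMap E E' g x v := by
  unfold tangentMap
  rw [h.eq_of_nhds]
  refine dirDeriv_congr ?_ v
  filter_upwards [(tendsto_chartAt_symm x).eventually h] with y hy
  simp only [Function.comp_apply, hy]

theorem LCDiffAt.tangentMap_add {f : M → N} {x : M} (hf : LCDiffAt E E' f x) (v w : E) :
    tangentMap E E' f x (v + w) = tangentMap E E' f x v + tangentMap E E' f x w :=
  hf.2.dirDeriv_add v w

theorem LCDiffAt.tangentMap_smul {f : M → N} {x : M} (hf : LCDiffAt E E' f x) (c : ℝ) (v : E) :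
    tangentMap E E' f x (c • v) = c • tangentMap E E' f x v :=
  hf.2.dirDeriv_smul c v

/-- The tangent map as a linear map. -/
noncomputable def LCDiffAt.tangentLin {f : M → N} {x : M} (hf : LCDiffAt E E' f x) : E →ₗ[ℝ] E' where
  toFun := tangentMap E E' f x
  map_add' := hf.tangentMap_add
  map_smul' := hf.tangentMap_smul

theorem tangentMap_id (x : M) (v : E) : tangentMap E E (fun y : M => y) x v = v := by
  unfold tangentMap
  have h : (chartAt E x ∘ (fun y : M => y) ∘ (chartAt E x).symm) =ᶠ[𝓝 (chartAt E x x)]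
      (ContinuousLinearMap.id ℝ E) := by
    filter_upwards [(chartAt E x).open_target.mem_nhds
      ((chartAt E x).map_source (mem_chart_source E x))] with y hy
    simp only [Function.comp_apply]
    exact (chartAt E x).right_inv hy
  rw [dirDeriv_congr h, dirDeriv_clm]
  rfl

theorem MSmoothOn.isOpen_chart_domain {f : M → N} {U : Set M} (h : ContinuousOn f U)
    (hU : IsOpen U) (e : OpenPartialHomeomorph M E) (e' : OpenPartialHomeomorph N E') :
    IsOpen (e.target ∩ e.symm ⁻¹' (U ∩ f ⁻¹' e'.source)) :=
  e.isOpen_inter_preimage_symm (h.isOpen_inter_preimage hU e'.open_source)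

theorem MSmoothOn.lcDiffAt {f : M → N} {U : Set M} (h : MSmoothOn E E' f U) (hU : IsOpen U)
    {x : M} (hx : x ∈ U) : LCDiffAt E E' f x := by
  refine ⟨h.1.continuousAt (hU.mem_nhds hx),
    (h.2 _ (chart_mem_atlas E x) _ (chart_mem_atlas E' (f x))).sDiffAt
      (MSmoothOn.isOpen_chart_domain h.1 hU _ _)
      ⟨(chartAt E x).map_source (mem_chart_source E x), ?_⟩⟩
  rw [mem_preimage, (chartAt E x).left_inv (mem_chart_source E x)]
  exact ⟨hx, mem_chart_source E' _⟩

theorem MSmooth.lcDiffAt {f : M → N} (h : MSmooth E E' f) (x : M) : LCDiffAt E E' f x :=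
  MSmoothOn.lcDiffAt h isOpen_univ (mem_univ x)

theorem MSmoothOn.mono {f : M → N} {U V : Set M} (h : MSmoothOn E E' f V) (hUV : U ⊆ V) :
    MSmoothOn E E' f U :=
  ⟨h.1.mono hUV, fun e he e' he' => (h.2 e he e' he').mono fun _ hy => ⟨hy.1, hUV hy.2.1, hy.2.2⟩⟩

theorem MSmoothOn.congr {f g : M → N} {U : Set M} (h : MSmoothOn E E' f U) (hU : IsOpen U)
    (hfg : EqOn f g U) : MSmoothOn E E' g U := by
  have hc : ContinuousOn g U := h.1.congr hfg.symm
  refine ⟨hc, fun e he e' he' => ((h.2 e he e' he').mono ?_).congr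
    (MSmoothOn.isOpen_chart_domain hc hU _ _) fun y hy => ?_⟩
  · rintro y ⟨hy, hy1, hy2⟩
    refine ⟨hy, hy1, ?_⟩
    rw [mem_preimage, hfg hy1]
    exact hy2
  · simp only [Function.comp_apply]
    rw [hfg hy.2.1]

theorem MSmoothOn.comp {f : M → N} {g : N → Q} {U : Set M} {V : Set N}
    (hg : MSmoothOn E' E'' g V) (hf : MSmoothOn E E' f U) (hU : IsOpen U) (hV : IsOpen V)
    (hUV : MapsTo f U V) : MSmoothOn E E'' (fun x => g (f x)) U := by
  have hc : ContinuousOn (fun x => g (f x)) U := hg.1.comp hf.1 hUV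
  refine ⟨hc, fun e he e'' he'' => bSmooth_of_locally
    (MSmoothOn.isOpen_chart_domain hc hU _ _) fun y hy => ?_⟩
  -- No single chart of `N` need cover the image, so an intermediate chart is chosen near each point
  -- and smoothness is checked locally.
  set e' := chartAt E' (f (e.symm y)) with he'
  refine ⟨_, MSmoothOn.isOpen_chart_domain hf.1 hU e e', ⟨hy.1, hy.2.1, mem_chart_source E' _⟩, ?_⟩
  refine ((BSmooth.comp (hg.2 e' (chart_mem_atlas E' _) e'' he'')
    ((hf.2 e he e' (chart_mem_atlas E' _)).mono inter_subset_right)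
    ((MSmoothOn.isOpen_chart_domain hc hU _ _).inter (MSmoothOn.isOpen_chart_domain hf.1 hU e e'))
    (MSmoothOn.isOpen_chart_domain hg.1 hV e' e'') ?_).congr
    ((MSmoothOn.isOpen_chart_domain hc hU _ _).inter (MSmoothOn.isOpen_chart_domain hf.1 hU e e'))
    ?_)
  · rintro z ⟨⟨hz, hz1, hz2⟩, -, -, hz3⟩
    refine ⟨e'.map_source hz3, ?_⟩
    simp only [mem_preimage, Function.comp_apply]
    rw [e'.left_inv hz3]
    exact ⟨hUV hz1, hz2⟩
  · rintro z ⟨-, -, -, hz3⟩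
    simp only [Function.comp_apply]
    rw [e'.left_inv hz3]

theorem MSmooth.comp {f : M → N} {g : N → Q} (hg : MSmooth E' E'' g) (hf : MSmooth E E' f) :
    MSmooth E E'' (fun x => g (f x)) :=
  MSmoothOn.comp hg hf isOpen_univ isOpen_univ (mapsTo_univ _ _)

theorem mSmoothOn_of_locally {f : M → N} {U : Set M} (hU : IsOpen U)
    (h : ∀ x ∈ U, ∃ V, IsOpen V ∧ x ∈ V ∧ MSmoothOn E E' f (U ∩ V)) : MSmoothOn E E' f U := by
  have hc : ContinuousOn f U := fun x hx => by
    obtain ⟨V, hV, hxV, hn⟩ := h x hx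
    exact (hn.1.continuousAt ((hU.inter hV).mem_nhds ⟨hx, hxV⟩)).continuousWithinAt
  refine ⟨hc, fun e he e' he' => bSmooth_of_locally
    (MSmoothOn.isOpen_chart_domain hc hU _ _) fun y hy => ?_⟩
  obtain ⟨V, hV, hxV, hn⟩ := h (e.symm y) hy.2.1
  refine ⟨_, e.isOpen_inter_preimage_symm hV, ⟨hy.1, hxV⟩, (hn.2 e he e' he').mono ?_⟩
  rintro z ⟨⟨hz, hz1, hz2⟩, -, hz3⟩
  exact ⟨hz, ⟨hz1, hz3⟩, hz2⟩

theorem mSmoothOn_const (c : N) {U : Set M} : MSmoothOn E E' (fun _ : M => c) U :=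
  ⟨continuousOn_const, fun _ _ e' _ => bSmooth_const (e' c) _⟩

theorem mSmoothOn_id [LCManifold E M] (U : Set M) : MSmoothOn E E (fun x : M => x) U :=
  ⟨continuousOn_id, fun e he e' he' => (LCManifold.compat e he e' he').mono
    fun _ hy => ⟨hy.1, hy.2.2⟩⟩

theorem mSmoothOn_chart [LCManifold E M] {e : OpenPartialHomeomorph M E} (he : e ∈ atlas E M) :
    MSmoothOn E E e e.source := by
  refine ⟨e.continuousOn, fun e1 he1 e2 he2 => ?_⟩
  rw [chartedSpaceSelf_atlas] at he2
  subst he2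
  exact (LCManifold.compat e1 he1 e he).mono fun y hy => ⟨hy.1, hy.2.1⟩

theorem mSmoothOn_chart_symm [LCManifold E M] {e : OpenPartialHomeomorph M E}
    (he : e ∈ atlas E M) : MSmoothOn E E e.symm e.target := by
  refine ⟨e.continuousOn_symm, fun e1 he1 e2 he2 => ?_⟩
  rw [chartedSpaceSelf_atlas] at he1
  subst he1
  exact (LCManifold.compat e he e2 he2).mono fun y hy => ⟨hy.2.1, hy.2.2⟩

theorem mSmoothOn_iff_bSmooth {f : E → E'} {U : Set E} :
    MSmoothOn E E' f U ↔ BSmooth f U := by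
  constructor
  · intro h
    exact (h.2 (OpenPartialHomeomorph.refl E) (by simp) (OpenPartialHomeomorph.refl E')
      (by simp)).mono fun y hy => ⟨mem_univ _, hy, mem_univ _⟩
  · intro h
    refine ⟨h.continuousOn, fun e he e' he' => ?_⟩
    rw [chartedSpaceSelf_atlas] at he he'
    subst he he'
    exact h.mono fun y hy => hy.2.1

theorem tangentMap_eq_dirDeriv (f : E → E') (x v : E) :
    tangentMap E E' f x v = dirDeriv f x v := rfl

theorem ofChart_eq_tangentMap (e : OpenPartialHomeomorph M E) (y v : E) :
    ofChart e y v = tangentMap E E e.symm y v := rfl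

theorem toChart_eq_tangentMap (e : OpenPartialHomeomorph M E) (x : M) (v : E) :
    toChart e x v = tangentMap E E e x v := rfl

theorem lcDiffAt_chart [LCManifold E M] {e : OpenPartialHomeomorph M E} (he : e ∈ atlas E M)
    {x : M} (hx : x ∈ e.source) : LCDiffAt E E e x :=
  (mSmoothOn_chart he).lcDiffAt e.open_source hx

theorem lcDiffAt_chart_symm [LCManifold E M] {e : OpenPartialHomeomorph M E} (he : e ∈ atlas E M)
    {y : E} (hy : y ∈ e.target) : LCDiffAt E E e.symm y :=
  (mSmoothOn_chart_symm he).lcDiffAt e.open_target hy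

theorem ofChart_toChart [LCManifold E M] {e : OpenPartialHomeomorph M E} (he : e ∈ atlas E M)
    {x : M} (hx : x ∈ e.source) (v : E) : ofChart e (e x) (toChart e x v) = v := by
  rw [toChart_eq_tangentMap, ofChart_eq_tangentMap,
    ← LCDiffAt.tangentMap_comp (lcDiffAt_chart_symm he (e.map_source hx)) (lcDiffAt_chart he hx),
    tangentMap_congr (g := fun y => y), tangentMap_id]
  filter_upwards [e.open_source.mem_nhds hx] with z hz using e.left_inv hz

theorem ofChart_chartAt (x : M) (v : E) :
    ofChart (chartAt E x) (chartAt E x x) v = v := by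
  have h := tangentMap_id (E := E) x v
  unfold ofChart
  rw [(chartAt E x).left_inv (mem_chart_source E x)]
  exact h

/-- The differential of the local representative of `f` is the local representative of the
tangent map of `f`. -/
theorem ofChart_dirDeriv_rep [LCManifold E M] [LCManifold E' N] {f : M → N}
    {e : OpenPartialHomeomorph M E} (he : e ∈ atlas E M) {e' : OpenPartialHomeomorph N E'}
    (he' : e' ∈ atlas E' N) {y : E} (hy : y ∈ e.target) (hf : LCDiffAt E E' f (e.symm y))
    (hfy : f (e.symm y) ∈ e'.source) (v : E) :
    ofChart e' (e' (f (e.symm y))) (dirDeriv (e' ∘ f ∘ e.symm) y v) =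
      tangentMap E E' f (e.symm y) (ofChart e y v) := by
  rw [ofChart_eq_tangentMap e, ← LCDiffAt.tangentMap_comp hf (lcDiffAt_chart_symm he hy)]
  have h1 : dirDeriv (e' ∘ f ∘ e.symm) y v = tangentMap E E' (fun z => e' (f (e.symm z))) y v := rfl
  rw [h1, LCDiffAt.tangentMap_comp (f := fun z => f (e.symm z)) (lcDiffAt_chart he' hfy)
    (hf.comp (lcDiffAt_chart_symm he hy)), ← toChart_eq_tangentMap, ofChart_toChart he' hfy]

end Manifold

/-! ### Products of manifolds -/

section Product

variable {E E' E'' : Type*} [AddCommGroup E] [Module ℝ E] [TopologicalSpace E] [LocConvex E]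
  [AddCommGroup E'] [Module ℝ E'] [TopologicalSpace E'] [LocConvex E']
  [AddCommGroup E''] [Module ℝ E''] [TopologicalSpace E''] [LocConvex E'']
  {M N Q : Type*} [TopologicalSpace M] [TopologicalSpace N] [TopologicalSpace Q]
  [ChartedSpace E M] [ChartedSpace E' N] [ChartedSpace E'' Q]

theorem MSmooth.prodMk {f : Q → M} {g : Q → N} (hf : MSmooth E'' E f) (hg : MSmooth E'' E' g) :
    MSmooth E'' (E × E') (fun x => (f x, g x)) := by
  refine ⟨hf.1.prodMk hg.1, ?_⟩
  rintro e he _ ⟨e1, he1, e2, he2, rfl⟩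
  exact ((hf.2 e he e1 he1).mono fun y hy => ⟨hy.1, mem_univ _, hy.2.2.1⟩).prodMk
    ((hg.2 e he e2 he2).mono fun y hy => ⟨hy.1, mem_univ _, hy.2.2.2⟩)

theorem lcDiffAt_snd (x : M × N) : LCDiffAt (E × E') E' (Prod.snd : M × N → N) x ∧
    ∀ v, tangentMap (E × E') E' (Prod.snd : M × N → N) x v = v.2 := by
  have h : ⇑(ContinuousLinearMap.snd ℝ E E') =ᶠ[𝓝 (chartAt (E × E') x x)]
      (chartAt E' x.2 ∘ (Prod.snd : M × N → N) ∘ (chartAt (E × E') x).symm) := by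
    filter_upwards [(chartAt (E × E') x).open_target.mem_nhds
      ((chartAt (E × E') x).map_source (mem_chart_source _ x))] with y hy
    exact ((chartAt E' x.2).right_inv hy.2).symm
  refine ⟨⟨continuous_snd.continuousAt, (sDiffAt_clm _ _).congr h⟩, fun v => ?_⟩
  unfold tangentMap
  rw [← dirDeriv_congr h, dirDeriv_clm]
  rfl

theorem tangentMap_prodMk_const (x : M) (c : N) (v : E) :
    tangentMap E (E × E') (fun y : M => (y, c)) x v = (v, 0) := by
  refine HasDirDeriv.dirDeriv_eq (HasDirDeriv.congr_of_eventuallyEq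
    (f := fun y : E => (y, chartAt E' c c)) ?_ ?_)
  · refine (tendsto_const_nhds (x := (v, (0 : E')))).congr' ?_
    filter_upwards [self_mem_nhdsWithin] with t ht
    have ht : t ≠ 0 := ht
    simp [smul_smul, ht]
  · filter_upwards [(chartAt E x).open_target.mem_nhds
      ((chartAt E x).map_source (mem_chart_source E x))] with y hy
    exact Prod.ext ((chartAt E x).right_inv hy).symm rfl

end Product

/-! ### Symmetry of second derivatives and consequences of the mean value theorem -/

section SecondDerivative

variable {E F : Type*} [AddCommGroup E] [Module ℝ E] [TopologicalSpace E] [LocConvex E]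
  [AddCommGroup F] [Module ℝ F] [TopologicalSpace F] [LocConvex F]

theorem exists_closed_convex_nhds {x : F} {W : Set F} (hW : W ∈ 𝓝 x) :
    ∃ V ∈ 𝓝 x, IsClosed V ∧ Convex ℝ V ∧ V ⊆ W := by
  obtain ⟨V', ⟨hV', hVc'⟩, hVW'⟩ := (closed_nhds_basis x).mem_iff.1 hW
  obtain ⟨V, ⟨hV, hVx⟩, hVV'⟩ := (LocallyConvexSpace.convex_basis (𝕜 := ℝ) x).mem_iff.1 hV'
  exact ⟨closure V, mem_of_superset hV subset_closure, isClosed_closure, hVx.closure,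
    (closure_minimal hVV' hVc').trans hVW'⟩

theorem exists_open_convex_nhds {x : E} {W : Set E} (hW : W ∈ 𝓝 x) :
    ∃ V, IsOpen V ∧ x ∈ V ∧ Convex ℝ V ∧ V ⊆ W := by
  obtain ⟨V, ⟨hV, hVx⟩, hVV⟩ := (LocallyConvexSpace.convex_basis (𝕜 := ℝ) x).mem_iff.1 hW
  exact ⟨interior V, isOpen_interior, mem_interior_iff_mem_nhds.2 hV, hVx.interior,
    interior_subset.trans hVV⟩

theorem eventually_segment_mem {x v : E} {A : Set E} (hA : A ∈ 𝓝 x) :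
    ∀ᶠ t in 𝓝 (0 : ℝ), ∀ s ∈ Icc (0 : ℝ) 1, x + s • t • v ∈ A := by
  refine isCompact_Icc.eventually_forall_of_forall_eventually
    (P := fun (t : ℝ) (s : ℝ) => x + s • t • v ∈ A) fun s _ => ?_
  have h1 : Continuous fun z : ℝ × ℝ => x + z.2 • z.1 • v := by fun_prop
  have h2 := h1.tendsto (0, s)
  simp only [zero_smul, smul_zero, add_zero] at h2
  exact h2 hA

theorem BSmooth.dirDeriv_right {f : E → F} {U : Set E} (h : BSmooth f U) (hU : IsOpen U) (v : E) :
    BSmooth (fun y => LCGeom.dirDeriv f y v) U :=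
  BSmooth.comp (g := fun z : E × E => LCGeom.dirDeriv f z.1 z.2) (f := fun y => (y, v))
    (h.dirDeriv hU) ((bSmooth_id U).prodMk (bSmooth_const v U)) hU (hU.prod isOpen_univ)
    fun _ hx => ⟨hx, mem_univ _⟩

/-- The second difference is symmetric in `v` and `w`, so this limit gives Schwarz's theorem. The
mean value theorem in direction `t • v`, applied to `t⁻² (f(z + t w) - f(z))`, reduces it to
difference quotients in direction `w` of the derivative along `v`, which strictness controls for all
`z` near `x`. -/
theorem tendsto_second_difference {f : E → F} {U : Set E} (hf : BSmooth f U) (hU : IsOpen U)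
    {x : E} (hx : x ∈ U) (v w : E) :
    Tendsto (fun t : ℝ => (t⁻¹ * t⁻¹) • ((f (x + t • v + t • w) - f (x + t • v)) -
      (f (x + t • w) - f x))) (𝓝[≠] 0) (𝓝 (dirDeriv (fun y => dirDeriv f y v) x w)) := by
  intro W hW
  obtain ⟨V, hV, hVc, hVx, hVW⟩ := exists_closed_convex_nhds hW
  have hst := ((hf.dirDeriv_right hU v).sDiffAt hU hx).2 w
  have h1 : Tendsto (fun p : E × ℝ => p.1) (𝓝 x ×ˢ 𝓝[≠] 0) (𝓝 x) := tendsto_fst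
  have h2 : Tendsto (fun p : E × ℝ => p.2) (𝓝 x ×ˢ 𝓝[≠] 0) (𝓝[≠] 0) := tendsto_snd
  have h3 := (hst.tendsto h1 (tendsto_const_nhds (x := w)) h2).eventually hV
  have h4 := (tendsto_add_smul h1 (tendsto_const_nhds (x := w)) h2).eventually (hU.mem_nhds hx)
  have h5 := h1.eventually (hU.mem_nhds hx)
  -- Conditions on the base point and on `t` are separated, so that the base point can run along the
  -- segment while `t` stays fixed.
  obtain ⟨p, hp, q, hq, hpq⟩ := eventually_prod_iff.1 ((h3.and h4).and h5)
  rw [mem_map]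
  filter_upwards [hq, self_mem_nhdsWithin,
    nhdsWithin_le_nhds (eventually_segment_mem (v := v) hp)] with t ht ht0 hseg
  have ht0 : t ≠ 0 := ht0
  refine hVW ?_
  have := sub_mem_of_hasDirDeriv (f := fun z => (t⁻¹ * t⁻¹) • (f (z + t • w) - f z))
    (f' := fun z => t⁻¹ • (dirDeriv f (z + t • w) v - dirDeriv f z v)) (y := x) (w := t • v)
    hVx hVc ?_ ?_
  · rw [← smul_sub] at this
    convert this using 3
  · intro s hs
    obtain ⟨⟨-, h6⟩, h7⟩ := hpq (hseg s hs) ht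
    have h8 := hf.hasDirDeriv hU h6 v
    have h9 := hf.hasDirDeriv hU h7 v
    have h10 : HasDirDeriv (fun z => f (z + t • w) - f z) (x + s • t • v) v
        (dirDeriv f (x + s • t • v + t • w) v - dirDeriv f (x + s • t • v) v) := by
      refine (h8.sub h9).congr fun r => ?_
      simp only
      rw [← smul_sub]
      congr 1
      rw [show x + s • t • v + t • w + r • v = x + s • t • v + r • v + t • w by abel]
      abel
    have h11 := (h10.smul_dir t).const_smul (t⁻¹ * t⁻¹)
    rwa [mul_smul _ _ (t • _), inv_smul_smul₀ ht0] at h11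
  · intro s hs
    exact (hpq (hseg s hs) ht).1.1

/-- Second derivatives are symmetric. -/
theorem BSmooth.dirDeriv_comm {f : E → F} {U : Set E} (hf : BSmooth f U) (hU : IsOpen U)
    {x : E} (hx : x ∈ U) (v w : E) :
    LCGeom.dirDeriv (fun y => LCGeom.dirDeriv f y v) x w =
      LCGeom.dirDeriv (fun y => LCGeom.dirDeriv f y w) x v := by
  refine tendsto_nhds_unique (tendsto_second_difference hf hU hx v w)
    ((tendsto_second_difference hf hU hx w v).congr fun t => ?_)
  congr 1
  rw [show x + t • w + t • v = x + t • v + t • w by abel]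
  abel

theorem sub_eq_zero_of_dirDeriv_eq_zero {f : E → F} {U : Set E} (hUc : Convex ℝ U)
    (hf : ∀ x ∈ U, ∀ v, HasDirDeriv f x v 0) {x y : E} (hx : x ∈ U) (hy : y ∈ U) :
    f y = f x := by
  have := sub_mem_of_hasDirDeriv (f := f) (f' := fun _ => 0) (y := x) (w := y - x)
    (convex_singleton (0 : F)) isClosed_singleton
    (fun s hs => hf _ (hUc.add_smul_sub_mem hx hy hs) _) (fun _ _ => rfl)
  rw [add_sub_cancel] at this
  exact sub_eq_zero.1 this

/-- By homogeneity `f' (x, 0) = 0`, so `f'` is small near `(x, 0)`, and the mean value theorem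
bounds `f y - f x`. This spares a separate continuity proof for primitives. -/
theorem continuousOn_of_hasDirDeriv {f : E → F} {f' : E × E → F} {U : Set E} (hU : IsOpen U)
    (hf : ∀ x ∈ U, ∀ v, HasDirDeriv f x v (f' (x, v))) (hf' : ContinuousOn f' (U ×ˢ univ)) :
    ContinuousOn f U := by
  intro x hx
  refine ContinuousAt.continuousWithinAt ?_
  obtain ⟨U', hU', hxU', hUc', hUU'⟩ := exists_open_convex_nhds (hU.mem_nhds hx)
  have h0 : f' (x, 0) = 0 := by
    have := (hf x hx 0).smul_dir 0
    rw [zero_smul, zero_smul] at this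
    exact tendsto_nhds_unique (hf x hx 0) this
  have h1 : Tendsto (fun y => f y - f x) (𝓝 x) (𝓝 0) := by
    intro W hW
    obtain ⟨V, hV, hVc, hVx, hVW⟩ := exists_closed_convex_nhds hW
    have h2 := isCompact_Icc.eventually_forall_of_forall_eventually (x₀ := x)
      (K := Icc (0 : ℝ) 1) (P := fun (y : E) (s : ℝ) => f' (x + s • (y - x), y - x) ∈ V) ?_
    · rw [mem_map]
      filter_upwards [h2, hU'.mem_nhds hxU'] with y hy hyU
      refine hVW ?_
      have := sub_mem_of_hasDirDeriv (f := f) (f' := fun z => f' (z, y - x)) (y := x)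
        (w := y - x) hVx hVc
        (fun s hs => hf _ (hUU' (hUc'.add_smul_sub_mem hxU' hyU hs)) _) (fun s hs => hy s hs)
      rwa [add_sub_cancel] at this
    · intro s _
      have h3 : Continuous fun z : E × ℝ => (x + z.2 • (z.1 - x), z.1 - x) := by fun_prop
      have h4 := h3.tendsto (x, s)
      simp only [sub_self, smul_zero, add_zero] at h4
      have h5 : Tendsto f' (𝓝 (x, 0)) (𝓝 0) := by
        have := hf'.continuousAt ((hU.prod isOpen_univ).mem_nhds (x := (x, (0 : E)))
          ⟨hx, mem_univ _⟩)
        rwa [ContinuousAt, h0] at this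
      exact (h5.comp h4) hV
  have := h1.add_const (f x)
  simpa [ContinuousAt] using this

end SecondDerivative

/-! ### Differential forms on open subsets of the model space; the Poincaré lemma -/

section LocalForms

variable {E E' F : Type*} [AddCommGroup E] [Module ℝ E] [TopologicalSpace E] [LocConvex E]
  [AddCommGroup E'] [Module ℝ E'] [TopologicalSpace E'] [LocConvex E']
  [AddCommGroup F] [Module ℝ F] [TopologicalSpace F] [LocConvex F]

/-- The exterior derivative of the `1`-form `A` on an open subset of `E`. -/
noncomputable def extDeriv₁ (A : E → E → F) (x v w : E) : F :=
  dirDeriv (fun y => A y w) x v - dirDeriv (fun y => A y v) x w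

theorem SDiffAt.dirDeriv_prodMk {f : E → E'} {g : E → F} {x : E} (hf : SDiffAt f x)
    (hg : SDiffAt g x) (v : E) :
    dirDeriv (fun y => (f y, g y)) x v = (dirDeriv f x v, dirDeriv g x v) :=
  HasDirDeriv.dirDeriv_eq ((hf.hasDirDeriv v).prodMk_nhds (hg.hasDirDeriv v))

/-- The derivative of a `1`-form, in the direction of a vector field. -/
theorem dirDeriv_form {A : E → E → F} {V : Set E} (hV : IsOpen V)
    (hA : BSmooth (fun z : E × E => A z.1 z.2) (V ×ˢ univ))
    (hadd : ∀ x ∈ V, ∀ v w, A x (v + w) = A x v + A x w)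
    (hsmul : ∀ x ∈ V, ∀ (c : ℝ) v, A x (c • v) = c • A x v) {x : E} (hx : x ∈ V) (u v w : E) :
    dirDeriv (fun z : E × E => A z.1 z.2) (x, u) (v, w) =
      dirDeriv (fun y => A y u) x v + A x w := by
  have h0 : SDiffAt (fun z : E × E => A z.1 z.2) (x, u) :=
    hA.sDiffAt (hV.prod isOpen_univ) ⟨hx, mem_univ _⟩
  have h1 : ((v, w) : E × E) = (v, 0) + (0, w) := by simp
  rw [h1, h0.dirDeriv_add]
  congr 1
  · symm
    refine HasDirDeriv.dirDeriv_eq ((h0.hasDirDeriv (v, 0)).congr fun t => ?_)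
    simp
  · refine HasDirDeriv.dirDeriv_eq ((tendsto_const_nhds (x := A x w)).congr' ?_)
    filter_upwards [self_mem_nhdsWithin] with t ht
    have ht : t ≠ 0 := ht
    simp [hadd x hx, hsmul x hx, smul_smul, ht]

/-- The exterior derivative commutes with pullbacks. -/
theorem extDeriv₁_pullback {A : E' → E' → F} {V : Set E'} (hV : IsOpen V)
    (hA : BSmooth (fun z : E' × E' => A z.1 z.2) (V ×ˢ univ))
    (hadd : ∀ x ∈ V, ∀ v w, A x (v + w) = A x v + A x w)
    (hsmul : ∀ x ∈ V, ∀ (c : ℝ) v, A x (c • v) = c • A x v)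
    {S : E → E'} {U : Set E} (hU : IsOpen U) (hS : BSmooth S U) (hUV : MapsTo S U V)
    {x : E} (hx : x ∈ U) (v w : E) :
    extDeriv₁ (fun y u => A (S y) (dirDeriv S y u)) x v w =
      extDeriv₁ A (S x) (dirDeriv S x v) (dirDeriv S x w) := by
  -- The last term contains the second derivative of `S`; it is symmetric in `v` and `w` and cancels
  -- on antisymmetrising.
  have key : ∀ v w, dirDeriv (fun y => A (S y) (dirDeriv S y w)) x v =
      dirDeriv (fun z => A z (dirDeriv S x w)) (S x) (dirDeriv S x v) +
        A (S x) (dirDeriv (fun y => dirDeriv S y w) x v) := by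
    intro v w
    have h1 := hS.sDiffAt hU hx
    have h2 := (hS.dirDeriv_right hU w).sDiffAt hU hx
    have h3 := (hS.prodMk (hS.dirDeriv_right hU w)).sDiffAt hU hx
    have h4 : SDiffAt (fun z : E' × E' => A z.1 z.2) (S x, dirDeriv S x w) :=
      hA.sDiffAt (hV.prod isOpen_univ) ⟨hUV hx, mem_univ _⟩
    rw [SDiffAt.dirDeriv_comp (g := fun z : E' × E' => A z.1 z.2)
      (f := fun y => (S y, dirDeriv S y w)) h4 h3,
      h1.dirDeriv_prodMk h2, dirDeriv_form hV hA hadd hsmul (hUV hx)]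
  simp only [extDeriv₁]
  rw [key, key, hS.dirDeriv_comm hU hx v w, add_sub_add_right_eq_sub]

theorem extDeriv₁_congr {A B : E → E → F} {x : E} (h : ∀ᶠ y in 𝓝 x, ∀ v, A y v = B y v)
    (v w : E) : extDeriv₁ A x v w = extDeriv₁ B x v w := by
  unfold extDeriv₁
  rw [dirDeriv_congr (h.mono fun y hy => hy w), dirDeriv_congr (h.mono fun y hy => hy v)]

/-- The Poincaré lemma for `1`-forms on convex open sets. -/
theorem exists_primitive_of_convex {A : E → E → ℝ} {W : Set E} (hW : IsOpen W)
    (hWc : Convex ℝ W) (hA : BSmooth (fun z : E × E => A z.1 z.2) (W ×ˢ univ))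
    (hadd : ∀ x ∈ W, ∀ v w, A x (v + w) = A x v + A x w)
    (hsmul : ∀ x ∈ W, ∀ (c : ℝ) v, A x (c • v) = c • A x v)
    (hclosed : ∀ x ∈ W, ∀ v w, extDeriv₁ A x v w = 0) :
    ∃ f : E → ℝ, BSmooth f W ∧ ∀ x ∈ W, ∀ v, dirDeriv f x v = A x v := by
  rcases W.eq_empty_or_nonempty with rfl | ⟨y₀, hy₀⟩
  · exact ⟨fun _ => 0, bSmooth_const _ _, by simp⟩
  have hO : IsOpen (W ×ˢ (univ : Set E)) := hW.prod isOpen_univ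
  -- The primitive integrates `A` along the straight segment from `y₀`.
  let f : E → ℝ := fun y => ∫ t in (0 : ℝ)..1, A (y₀ + t • (y - y₀)) (y - y₀)
  suffices hf : ∀ y ∈ W, ∀ v, HasDirDeriv f y v (A y v) from
    ⟨f, bSmooth_of_hasDirDeriv (f' := fun z => A z.1 z.2)
      (continuousOn_of_hasDirDeriv hW hf hA.continuousOn) hf hA, fun x hx v =>
      (hf x hx v).dirDeriv_eq⟩
  intro y hy v
  rw [hasDirDeriv_iff_hasDerivAt]
  -- Moving `y` to `y + s • v` moves the argument of `A` in `E × E` along the line `p t + s • q t`,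
  -- so `Q` is the `s`-derivative of the integrand.
  let p : ℝ → E × E := fun t => (y₀ + t • (y - y₀), y - y₀)
  let q : ℝ → E × E := fun t => (t • v, v)
  let P : ℝ → ℝ → ℝ := fun s t => A (p t + s • q t).1 (p t + s • q t).2
  let Q : ℝ → ℝ → ℝ := fun s t => dirDeriv (fun z : E × E => A z.1 z.2) (p t + s • q t) (q t)
  have hfP : ∀ s, f (y + s • v) = ∫ t in (0 : ℝ)..1, P s t := by
    intro s
    refine intervalIntegral.integral_congr fun t _ => ?_
    simp only [P, p, q, Prod.fst_add, Prod.snd_add, Prod.smul_fst, Prod.smul_snd]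
    congr 1
    · simp only [smul_sub, smul_add, smul_comm s t v]
      abel
    · abel
  have hpq : Continuous fun z : ℝ × ℝ => p z.2 + z.1 • q z.2 := by fun_prop
  have hqc : Continuous q := by fun_prop
  have hQ : ∀ s t, p t + s • q t ∈ W ×ˢ (univ : Set E) →
      ContinuousAt (fun z : ℝ × ℝ => Q z.1 z.2) (s, t) := by
    intro s t h
    have h1 := (hA.dirDeriv hO).continuousOn.continuousAt
      ((hO.prod isOpen_univ).mem_nhds (x := (p t + s • q t, q t)) ⟨h, mem_univ _⟩)
    have h2 : Continuous fun z : ℝ × ℝ => (p z.2 + z.1 • q z.2, q z.2) := by fun_prop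
    exact ContinuousAt.comp (f := fun z : ℝ × ℝ => (p z.2 + z.1 • q z.2, q z.2)) (x := (s, t))
      h1 h2.continuousAt
  have hP : ∀ s t, p t + s • q t ∈ W ×ˢ (univ : Set E) → ContinuousAt (P s) t := by
    intro s t h
    have h1 := hA.continuousOn.continuousAt (hO.mem_nhds h)
    have h2 : Continuous fun t : ℝ => p t + s • q t := by fun_prop
    exact ContinuousAt.comp (f := fun t : ℝ => p t + s • q t) (x := t) h1 h2.continuousAt
  have h01 : ∀ t ∈ Icc (0 : ℝ) 1, y₀ + t • (y - y₀) ∈ W := fun t ht =>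
    hWc.add_smul_sub_mem hy₀ hy ht
  have h0mem : ∀ t ∈ Icc (0 : ℝ) 1, p t + (0 : ℝ) • q t ∈ W ×ˢ (univ : Set E) := by
    intro t ht
    rw [zero_smul, add_zero]
    exact ⟨h01 t ht, mem_univ _⟩
  have hQ0 : ContinuousOn (Q 0) (Icc 0 1) := fun t ht => by
    have : Continuous fun t : ℝ => ((0 : ℝ), t) := by fun_prop
    exact (ContinuousAt.comp (f := fun t : ℝ => ((0 : ℝ), t)) (x := t) (hQ 0 t (h0mem t ht))
      this.continuousAt).continuousWithinAt
  obtain ⟨C, hC⟩ := isCompact_Icc.exists_bound_of_continuousOn hQ0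
  -- Compactness in `t` extends the bound at `s = 0`, with slack `1`, to small `s`; this dominates
  -- the differentiation under the integral.
  have hev : ∀ᶠ s in 𝓝 (0 : ℝ), ∀ t ∈ Icc (0 : ℝ) 1,
      p t + s • q t ∈ W ×ˢ (univ : Set E) ∧ ‖Q s t‖ ≤ C + 1 := by
    refine isCompact_Icc.eventually_forall_of_forall_eventually
      (P := fun (s : ℝ) (t : ℝ) => p t + s • q t ∈ W ×ˢ (univ : Set E) ∧ ‖Q s t‖ ≤ C + 1)
      fun t ht => ?_
    have h1 := (hQ 0 t (h0mem t ht)).norm.eventually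
      (gt_mem_nhds (lt_of_le_of_lt (hC t ht) (lt_add_one C)))
    filter_upwards [h1, (hpq.tendsto (0, t)).eventually (hO.mem_nhds (h0mem t ht))] with z h2 h3
    exact ⟨h3, h2.le⟩
  have hI : uIcc (0 : ℝ) 1 = Icc 0 1 := uIcc_of_le zero_le_one
  have hIoc : ∀ t ∈ uIoc (0 : ℝ) 1, t ∈ Icc (0 : ℝ) 1 := fun t ht => hI ▸ uIoc_subset_uIcc ht
  have hPint : ∀ᶠ s in 𝓝 (0 : ℝ), IntervalIntegrable (P s) MeasureTheory.volume 0 1 := by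
    filter_upwards [hev] with s hs
    refine ContinuousOn.intervalIntegrable fun t ht => ?_
    rw [hI] at ht
    exact (hP s t (hs t ht).1).continuousWithinAt
  have hQint : IntervalIntegrable (Q 0) MeasureTheory.volume 0 1 :=
    ContinuousOn.intervalIntegrable (hI ▸ hQ0)
  have hmain := (intervalIntegral.hasDerivAt_integral_of_dominated_loc_of_deriv_le (𝕜 := ℝ)
    (μ := MeasureTheory.volume) (a := 0) (b := 1) (F := P) (F' := Q) (x₀ := 0)
    (bound := fun _ => C + 1) hev (hPint.mono fun s hs => (intervalIntegrable_iff.1 hs).1)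
    hPint.self_of_nhds (intervalIntegrable_iff.1 hQint).1
    (Eventually.of_forall fun t ht s hs => (hs t (hIoc t ht)).2) intervalIntegrable_const
    (Eventually.of_forall fun t ht s hs => HasDirDeriv.hasDerivAt
      (f := fun z : E × E => A z.1 z.2)
      (hA.hasDirDeriv hO (hs t (hIoc t ht)).1 (q t)))).2
  have hval : ∫ t in (0 : ℝ)..1, Q 0 t = A y v := by
    -- Closedness exchanges `v` and `y - y₀` in the derivative of `A`, turning the integrand into an
    -- exact `t`-derivative.
    have hF : ∀ t ∈ uIcc (0 : ℝ) 1,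
        HasDerivAt (fun t : ℝ => t * A (y₀ + t • (y - y₀)) v) (Q 0 t) t := by
      intro t ht
      rw [hI] at ht
      have hAv : BSmooth (fun z => A z v) W :=
        hA.comp ((bSmooth_id W).prodMk (bSmooth_const v W)) hW hO fun _ hx => ⟨hx, mem_univ _⟩
      have h1 := HasDirDeriv.hasDerivAt (hAv.hasDirDeriv hW (h01 t ht) (y - y₀))
      have h2 := (hasDerivAt_id t).mul h1
      have h3 : Q 0 t = 1 * A (y₀ + t • (y - y₀)) v +
          t * dirDeriv (fun z => A z v) (y₀ + t • (y - y₀)) (y - y₀) := by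
        have h4 := hclosed _ (h01 t ht) (y - y₀) v
        have hAw : BSmooth (fun z => A z (y - y₀)) W :=
          hA.comp ((bSmooth_id W).prodMk (bSmooth_const (y - y₀) W)) hW hO
            fun _ hx => ⟨hx, mem_univ _⟩
        simp only [Q, zero_smul, add_zero, p, q]
        rw [dirDeriv_form hW hA hadd hsmul (h01 t ht),
          (hAw.sDiffAt hW (h01 t ht)).dirDeriv_smul, sub_eq_zero.1 h4, smul_eq_mul]
        ring
      rw [h3]
      exact h2
    rw [intervalIntegral.integral_eq_sub_of_hasDerivAt hF hQint]
    simp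
  rw [hval] at hmain
  exact hmain.congr_of_eventuallyEq (Eventually.of_forall hfP)

end LocalForms

/-! ### One-forms on manifolds: pullback, exterior derivative, local primitives -/

section Forms

variable {E E' F : Type*} [AddCommGroup E] [Module ℝ E] [TopologicalSpace E] [LocConvex E]
  [AddCommGroup E'] [Module ℝ E'] [TopologicalSpace E'] [LocConvex E']
  [AddCommGroup F] [Module ℝ F] [TopologicalSpace F] [LocConvex F]
  {M N : Type*} [TopologicalSpace M] [TopologicalSpace N]
  [ChartedSpace E M] [ChartedSpace E' N] [LCManifold E M] [LCManifold E' N]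

theorem OneForm.rep_add (α : OneForm E M F) {e : OpenPartialHomeomorph M E}
    (he : e ∈ atlas E M) {y : E} (hy : y ∈ e.target) (v w : E) :
    α.rep e y (v + w) = α.rep e y v + α.rep e y w := by
  unfold OneForm.rep
  rw [ofChart_eq_tangentMap, (lcDiffAt_chart_symm he hy).tangentMap_add, map_add]
  rfl

theorem OneForm.rep_smul (α : OneForm E M F) {e : OpenPartialHomeomorph M E}
    (he : e ∈ atlas E M) {y : E} (hy : y ∈ e.target) (c : ℝ) (v : E) :
    α.rep e y (c • v) = c • α.rep e y v := by
  unfold OneForm.rep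
  rw [ofChart_eq_tangentMap, (lcDiffAt_chart_symm he hy).tangentMap_smul, map_smul]
  rfl

theorem OneForm.rep_chartAt (α : OneForm E M F) (x : M) (v : E) :
    α.rep (chartAt E x) (chartAt E x x) v = α x v := by
  unfold OneForm.rep
  rw [ofChart_chartAt, (chartAt E x).left_inv (mem_chart_source E x)]

theorem OneForm.d_eq_extDeriv₁ (α : OneForm E M F) (x : M) (v w : E) :
    α.d x v w = extDeriv₁ (α.rep (chartAt E x)) (chartAt E x x) v w := rfl

/-- `β` is the pullback of `α` along `f`, on `U`. -/
def OneForm.IsPullbackOn (β : OneForm E M F) (α : OneForm E' N F) (f : M → N) (U : Set M) : Prop :=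
  ∀ x ∈ U, ∀ v, β x v = α (f x) (tangentMap E E' f x v)

theorem OneForm.IsPullbackOn.rep_eq {β : OneForm E M F} {α : OneForm E' N F} {f : M → N}
    {U : Set M} (h : β.IsPullbackOn α f U) (hU : IsOpen U) (hf : MSmoothOn E E' f U)
    {e : OpenPartialHomeomorph M E} (he : e ∈ atlas E M)
    {e' : OpenPartialHomeomorph N E'} (he' : e' ∈ atlas E' N) {y : E}
    (hy : y ∈ e.target ∩ e.symm ⁻¹' (U ∩ f ⁻¹' e'.source)) (v : E) :
    β.rep e y v = α.rep e' ((e' ∘ f ∘ e.symm) y) (dirDeriv (e' ∘ f ∘ e.symm) y v) := by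
  unfold OneForm.rep
  rw [h _ hy.2.1]
  simp only [Function.comp_apply]
  have h1 := ofChart_dirDeriv_rep he he' hy.1 (hf.lcDiffAt hU hy.2.1) hy.2.2 v
  rw [e'.left_inv hy.2.2, ← h1]

theorem OneForm.IsPullbackOn.bSmooth_rep {β : OneForm E M F} {α : OneForm E' N F} {f : M → N}
    {U : Set M} (h : β.IsPullbackOn α f U) (hU : IsOpen U) (hf : MSmoothOn E E' f U)
    (hα : α.IsSmooth) {e : OpenPartialHomeomorph M E} (he : e ∈ atlas E M)
    {e' : OpenPartialHomeomorph N E'} (he' : e' ∈ atlas E' N) :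
    BSmooth (fun z : E × E => β.rep e z.1 z.2)
      ((e.target ∩ e.symm ⁻¹' (U ∩ f ⁻¹' e'.source)) ×ˢ univ) := by
  have hD := MSmoothOn.isOpen_chart_domain hf.1 hU e e'
  have hF := hf.2 e he e' he'
  refine BSmooth.congr (f := fun z : E × E =>
    α.rep e' ((e' ∘ f ∘ e.symm) z.1) (dirDeriv (e' ∘ f ∘ e.symm) z.1 z.2)) ?_
    (hD.prod isOpen_univ) fun z hz => (h.rep_eq hU hf he he' hz.1 z.2).symm
  exact BSmooth.comp (g := fun z : E' × E' => α.rep e' z.1 z.2)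
    (f := fun z : E × E => ((e' ∘ f ∘ e.symm) z.1, dirDeriv (e' ∘ f ∘ e.symm) z.1 z.2))
    (hα e' he') (hF.fst_prod.prodMk (hF.dirDeriv hD)) (hD.prod isOpen_univ)
    (e'.open_target.prod isOpen_univ) fun z hz => ⟨e'.map_source hz.1.2.2, mem_univ _⟩

theorem OneForm.IsPullbackOn.extDeriv₁_rep {β : OneForm E M F} {α : OneForm E' N F} {f : M → N}
    {U : Set M} (h : β.IsPullbackOn α f U) (hU : IsOpen U) (hf : MSmoothOn E E' f U)
    (hα : α.IsSmooth) {e : OpenPartialHomeomorph M E} (he : e ∈ atlas E M)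
    {e' : OpenPartialHomeomorph N E'} (he' : e' ∈ atlas E' N) {y : E}
    (hy : y ∈ e.target ∩ e.symm ⁻¹' (U ∩ f ⁻¹' e'.source)) (v w : E) :
    extDeriv₁ (β.rep e) y v w = extDeriv₁ (α.rep e') ((e' ∘ f ∘ e.symm) y)
      (dirDeriv (e' ∘ f ∘ e.symm) y v) (dirDeriv (e' ∘ f ∘ e.symm) y w) := by
  have hD := MSmoothOn.isOpen_chart_domain hf.1 hU e e'
  rw [← extDeriv₁_pullback e'.open_target (hα e' he') (fun x hx => α.rep_add he' hx)
    (fun x hx => α.rep_smul he' hx) hD (hf.2 e he e' he')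
    (fun z hz => e'.map_source hz.2.2) hy]
  refine extDeriv₁_congr ?_ v w
  filter_upwards [hD.mem_nhds hy] with z hz v using h.rep_eq hU hf he he' hz v

/-- The exterior derivative commutes with pullbacks. -/
theorem OneForm.IsPullbackOn.d_eq {β : OneForm E M F} {α : OneForm E' N F} {f : M → N}
    {U : Set M} (h : β.IsPullbackOn α f U) (hU : IsOpen U) (hf : MSmoothOn E E' f U)
    (hα : α.IsSmooth) {x : M} (hx : x ∈ U) (v w : E) :
    β.d x v w = α.d (f x) (tangentMap E E' f x v) (tangentMap E E' f x w) := by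
  rw [OneForm.d_eq_extDeriv₁, h.extDeriv₁_rep hU hf hα (chart_mem_atlas E x)
    (chart_mem_atlas E' (f x)) ⟨(chartAt E x).map_source (mem_chart_source E x), ?_⟩,
    chart_rep_apply]
  · rfl
  · rw [mem_preimage, (chartAt E x).left_inv (mem_chart_source E x)]
    exact ⟨hx, mem_chart_source E' _⟩

/-- Chart independence of `d`, which is defined through preferred charts: `α` is its own pullback
along the identity. -/
theorem OneForm.extDeriv₁_rep {α : OneForm E M F} (hα : α.IsSmooth)
    {e : OpenPartialHomeomorph M E} (he : e ∈ atlas E M) {y : E} (hy : y ∈ e.target) (v w : E) :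
    extDeriv₁ (α.rep e) y v w = α.d (e.symm y) (ofChart e y v) (ofChart e y w) := by
  have h : α.IsPullbackOn α (fun x : M => x) univ := fun x _ v => by rw [tangentMap_id]
  rw [h.extDeriv₁_rep isOpen_univ (mSmoothOn_id univ) hα he (chart_mem_atlas E (e.symm y))
    ⟨hy, mem_univ _, mem_chart_source E _⟩]
  rfl

/-- Closed `1`-forms are locally exact. -/
theorem OneForm.exists_local_primitive {β : OneForm E M ℝ} (hβ : β.IsSmooth)
    (hd : ∀ x v w, β.d x v w = 0) (x : M) :
    ∃ (U : Set M) (f : M → ℝ), IsOpen U ∧ x ∈ U ∧ MSmoothOn E ℝ f U ∧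
      ∀ y ∈ U, ∀ v, tangentMap E ℝ f y v = β y v := by
  set e := chartAt E x
  have he : e ∈ atlas E M := chart_mem_atlas E x
  have hx : x ∈ e.source := mem_chart_source E x
  obtain ⟨W, hW, hxW, hWc, hWt⟩ := exists_open_convex_nhds
    (e.open_target.mem_nhds (e.map_source hx))
  obtain ⟨f, hf, hf'⟩ := exists_primitive_of_convex (A := β.rep e) hW hWc
    ((hβ e he).mono (prod_mono hWt le_rfl)) (fun y hy => β.rep_add he (hWt hy))
    (fun y hy => β.rep_smul he (hWt hy)) fun y hy v w => by
      rw [OneForm.extDeriv₁_rep hβ he (hWt hy), hd]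
  have hU : IsOpen (e.source ∩ e ⁻¹' W) := e.isOpen_inter_preimage hW
  refine ⟨e.source ∩ e ⁻¹' W, fun y => f (e y), hU, ⟨hx, hxW⟩, ?_, ?_⟩
  · exact (mSmoothOn_iff_bSmooth.2 hf).comp ((mSmoothOn_chart he).mono inter_subset_left)
      hU hW fun y hy => hy.2
  · rintro y ⟨hy, hyW⟩ v
    rw [LCDiffAt.tangentMap_comp ((mSmoothOn_iff_bSmooth.2 hf).lcDiffAt hW hyW)
      (lcDiffAt_chart he hy), tangentMap_eq_dirDeriv, hf' _ hyW, ← toChart_eq_tangentMap,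
      OneForm.rep, ofChart_toChart he hy, e.left_inv hy]

/-- Two primitives of a `1`-form differ by a locally constant function. -/
theorem eventually_sub_eq_of_tangentMap_eq {f g : M → F} {U : Set M} (hU : IsOpen U)
    (hf : MSmoothOn E F f U) (hg : MSmoothOn E F g U)
    (h : ∀ y ∈ U, ∀ v, tangentMap E F f y v = tangentMap E F g y v) {x : M} (hx : x ∈ U) :
    ∀ᶠ y in 𝓝 x, f y - g y = f x - g x := by
  set e := chartAt E x
  have he : e ∈ atlas E M := chart_mem_atlas E x
  have hxe : x ∈ e.source := mem_chart_source E x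
  have hD : IsOpen (e.target ∩ e.symm ⁻¹' U) := e.isOpen_inter_preimage_symm hU
  have hxD : e x ∈ e.target ∩ e.symm ⁻¹' U :=
    ⟨e.map_source hxe, by rwa [mem_preimage, e.left_inv hxe]⟩
  obtain ⟨W, hW, hxW, hWc, hWD⟩ := exists_open_convex_nhds (hD.mem_nhds hxD)
  have key : ∀ k : M → F, MSmoothOn E F k U → ∀ y ∈ W, ∀ v,
      HasDirDeriv (fun y => k (e.symm y)) y v (tangentMap E F k (e.symm y) (ofChart e y v)) := by
    intro k hk y hy v
    rw [ofChart_eq_tangentMap, ← LCDiffAt.tangentMap_comp (hk.lcDiffAt hU (hWD hy).2)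
      (lcDiffAt_chart_symm he (hWD hy).1), tangentMap_eq_dirDeriv]
    exact (mSmoothOn_iff_bSmooth.1 (hk.comp ((mSmoothOn_chart_symm he).mono inter_subset_left)
      hD hU fun y hy => hy.2)).hasDirDeriv hD (hWD hy) v
  have h0 : ∀ y ∈ W, ∀ v,
      HasDirDeriv (fun y => f (e.symm y) - g (e.symm y)) y v 0 := by
    intro y hy v
    have h1 := (key f hf y hy v).sub (key g hg y hy v)
    rw [h _ (hWD hy).2, sub_self] at h1
    refine h1.congr fun t => ?_
    rw [← smul_sub]
    beta_reduce
    congr 1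
    abel
  filter_upwards [(e.isOpen_inter_preimage hW).mem_nhds ⟨hxe, hxW⟩] with y hy
  have := sub_eq_zero_of_dirDeriv_eq_zero hWc h0 hxW hy.2
  simpa only [e.left_inv hxe, e.left_inv hy.1] using this

end Forms

/-! ### Gluing local primitives by covering theory -/

section Monodromy

/-- The real numbers with the discrete topology. -/
def DiscreteReal : Type := ℝ

instance : TopologicalSpace DiscreteReal := ⊥

instance : DiscreteTopology DiscreteReal := ⟨rfl⟩

def DiscreteReal.toReal (r : DiscreteReal) : ℝ := r

def DiscreteReal.ofReal (r : ℝ) : DiscreteReal := r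

theorem DiscreteReal.toReal_ofReal (r : ℝ) : (DiscreteReal.ofReal r).toReal = r := rfl

theorem DiscreteReal.ofReal_toReal (r : DiscreteReal) : DiscreteReal.ofReal r.toReal = r := rfl

/-- On a simply connected space, local functions which differ by locally constant functions can
be glued, up to locally constant functions. -/
theorem exists_global_of_locally_constant_sub {B : Type*} [TopologicalSpace B]
    [SimplyConnectedSpace B] [LocallyPathConnectedSpace B] (U : B → Set B) (f : B → B → ℝ)
    (hU : ∀ i, IsOpen (U i)) (hmem : ∀ x, x ∈ U x)
    (h : ∀ i j, ∀ x ∈ U i ∩ U j, ∀ᶠ y in 𝓝 x, f i y - f j y = f i x - f j x) :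
    ∃ Ψ : B → ℝ, ∀ i, ∀ x ∈ U i, ∀ᶠ y in 𝓝 x, Ψ y - f i y = Ψ x - f i x := by
  -- The coordinate `r` over `x` in the chart `i` encodes the candidate value `f i x + r`. The
  -- transition functions are locally constant, hence continuous for the discrete fibre, and the
  -- total space is a covering.
  let Z : FiberBundleCore B B DiscreteReal :=
    { baseSet := U
      isOpen_baseSet := hU
      indexAt := id
      mem_baseSet_at := hmem
      coordChange := fun i j x r => DiscreteReal.ofReal (r.toReal + (f i x - f j x))
      coordChange_self := fun i x _ r => by
        rw [sub_self, add_zero, DiscreteReal.ofReal_toReal]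
      continuousOn_coordChange := fun i j => by
        rintro ⟨x, r⟩ ⟨hx, -⟩
        refine ContinuousAt.continuousWithinAt ?_
        rw [ContinuousAt, nhds_discrete DiscreteReal, tendsto_pure, nhds_prod_eq,
          nhds_discrete DiscreteReal]
        have h1 : ∀ᶠ z in 𝓝 x ×ˢ pure r, f i z.1 - f j z.1 = f i x - f j x :=
          tendsto_fst.eventually (h i j x hx)
        have h2 : ∀ᶠ z in 𝓝 x ×ˢ (pure r : Filter DiscreteReal), z.2 = r :=
          tendsto_snd.eventually (p := fun q => q = r) (eventually_pure.2 rfl)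
        filter_upwards [h1, h2] with z hz hz'
        rw [hz, hz']
      coordChange_comp := fun i j k x _ r => by
        rw [DiscreteReal.toReal_ofReal, add_assoc, sub_add_sub_cancel] }
  have hcov : IsCoveringMap (Bundle.TotalSpace.proj : Bundle.TotalSpace DiscreteReal Z.Fiber → B) :=
    FiberBundle.isCoveringMap
  obtain ⟨b₀⟩ : Nonempty B := inferInstance
  -- Simple connectedness lifts the identity of `B`, which is a global section.
  obtain ⟨s, ⟨-, hs⟩, -⟩ := hcov.existsUnique_continuousMap_lifts (ContinuousMap.id B) b₀
    ⟨b₀, DiscreteReal.ofReal 0⟩ rfl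
  have hs' : ∀ x, (s x).1 = x := fun x => congrFun hs x
  let fib : Bundle.TotalSpace DiscreteReal Z.Fiber → ℝ :=
    fun p => DiscreteReal.toReal p.2
  refine ⟨fun x => fib (s x) + f (s x).1 (s x).1, fun i x hx => ?_⟩
  have h1 : ∀ y, (fib (s y) + f (s y).1 (s y).1) - f i y = ((Z.localTriv i) (s y)).2.toReal := by
    intro y
    have h2 : ((Z.localTriv i) (s y)).2.toReal =
      fib (s y) + (f (s y).1 (s y).1 - f i (s y).1) := rfl
    rw [h2, hs' y]
    ring
  have hsrc : s x ∈ (Z.localTriv i).source := by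
    rw [Z.mem_localTriv_source]
    change (s x).1 ∈ U i
    rwa [hs' x]
  -- Continuity into the discrete fibre means that the coordinate `Ψ - f i` is locally constant.
  have hc : ContinuousAt (fun y => ((Z.localTriv i) (s y)).2) x :=
    continuous_snd.continuousAt.comp
      (ContinuousAt.comp (f := s) ((Z.localTriv i).continuousAt hsrc) s.continuous.continuousAt)
  rw [ContinuousAt, nhds_discrete DiscreteReal, tendsto_pure] at hc
  filter_upwards [hc] with y hy
  rw [h1, h1, hy]

end Monodromy

/-! ### Global primitives of closed one-forms -/

section Primitive

variable {E : Type*} [AddCommGroup E] [Module ℝ E] [TopologicalSpace E] [LocConvex E]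
  {M : Type*} [TopologicalSpace M] [ChartedSpace E M] [LCManifold E M]

theorem MSmoothOn.add_const {f : M → ℝ} {U : Set M} (hf : MSmoothOn E ℝ f U) (hU : IsOpen U)
    (c : ℝ) : MSmoothOn E ℝ (fun x => f x + c) U :=
  MSmoothOn.comp (g := fun y : ℝ => y + c) (mSmoothOn_iff_bSmooth.2
    ((bSmooth_id univ).add isOpen_univ (bSmooth_const c univ))) hf hU isOpen_univ (mapsTo_univ _ _)

theorem tangentMap_add_const (f : M → ℝ) (c : ℝ) (x : M) (v : E) :
    tangentMap E ℝ (fun x => f x + c) x v = tangentMap E ℝ f x v := by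
  simp [tangentMap, dirDeriv, chartAt_self_eq]

/-- Closed `1`-forms on simply connected manifolds are exact. -/
theorem OneForm.exists_primitive [SimplyConnectedSpace M] {β : OneForm E M ℝ} (hβ : β.IsSmooth)
    (hd : ∀ x v w, β.d x v w = 0) :
    ∃ Ψ : M → ℝ, MSmooth E ℝ Ψ ∧ ∀ x v, tangentMap E ℝ Ψ x v = β x v := by
  have : LocallyPathConnectedSpace M := ChartedSpace.locallyPathConnectedSpace E M
  choose U f hU hmem hf hf' using OneForm.exists_local_primitive hβ hd
  obtain ⟨Ψ, hΨ⟩ := exists_global_of_locally_constant_sub U f hU hmem fun i j x hx =>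
    eventually_sub_eq_of_tangentMap_eq ((hU i).inter (hU j)) ((hf i).mono inter_subset_left)
      ((hf j).mono inter_subset_right)
      (fun y hy v => by rw [hf' i y hy.1, hf' j y hy.2]) hx
  have hloc : ∀ x, ∀ᶠ y in 𝓝 x, f x y + (Ψ x - f x x) = Ψ y := fun x => by
    filter_upwards [hΨ x x (hmem x)] with y hy
    rw [← hy]
    ring
  refine ⟨Ψ, mSmoothOn_of_locally isOpen_univ fun x _ => ?_, fun x v => ?_⟩
  · obtain ⟨V, hV, hVo, hxV⟩ := eventually_nhds_iff.1 (hloc x)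
    refine ⟨V ∩ U x, hVo.inter (hU x), ⟨hxV, hmem x⟩, ?_⟩
    rw [univ_inter]
    exact (((hf x).mono inter_subset_right).add_const (hVo.inter (hU x)) (Ψ x - f x x)).congr
      (hVo.inter (hU x)) fun y hy => hV y hy.1
  · rw [← tangentMap_congr (hloc x), tangentMap_add_const, hf' x x (hmem x)]

theorem exists_eq_add_const_of_tangentMap_eq [PreconnectedSpace M] [Nonempty M] {f g : M → ℝ}
    (hf : MSmooth E ℝ f) (hg : MSmooth E ℝ g)
    (h : ∀ x v, tangentMap E ℝ f x v = tangentMap E ℝ g x v) :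
    ∃ c : ℝ, ∀ x, f x = g x + c := by
  have hl : IsLocallyConstant fun x => f x - g x := IsLocallyConstant.iff_eventually_eq _ |>.2
    fun x => eventually_sub_eq_of_tangentMap_eq isOpen_univ hf hg (fun y _ => h y) (mem_univ x)
  obtain ⟨x₀⟩ : Nonempty M := inferInstance
  refine ⟨f x₀ - g x₀, fun x => ?_⟩
  have := hl.apply_eq_of_preconnectedSpace x x₀
  rw [← this]
  ring

end Primitive

/-! ### Principal bundles: sections, fibres and vertical vectors -/

section Bundle

variable {EG : Type*} [AddCommGroup EG] [Module ℝ EG] [TopologicalSpace EG] [LocConvex EG]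
  {G : Type*} [Group G] [TopologicalSpace G] [ChartedSpace EG G] [LCLieGroup EG G]
  {EP : Type*} [AddCommGroup EP] [Module ℝ EP] [TopologicalSpace EP] [LocConvex EP]
  {P : Type*} [TopologicalSpace P] [ChartedSpace EP P] [LCManifold EP P] [MulAction G P]
  {EB : Type*} [AddCommGroup EB] [Module ℝ EB] [TopologicalSpace EB] [LocConvex EB]
  {B : Type*} [TopologicalSpace B] [ChartedSpace EB B] [LCManifold EB B]

theorem mSmooth_id : MSmooth EP EP (fun x : P => x) := mSmoothOn_id univ

theorem IsSmoothAction.mSmooth_smul (h : IsSmoothAction EG G EP P) (g : G) :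
    MSmooth EP EP (fun p : P => g • p) :=
  MSmooth.comp (g := fun z : G × P => z.1 • z.2) h (MSmooth.prodMk (mSmoothOn_const g) mSmooth_id)

theorem mSmooth_mul_right (g : G) : MSmooth EG EG (fun h : G => h * g) :=
  MSmooth.comp (g := fun z : G × G => z.1 * z.2) LCLieGroup.smooth_mul (MSmooth.prodMk (mSmoothOn_id univ) (mSmoothOn_const g))

/-- Right translation by `g⁻¹` is a smooth inverse. In a trivialisation orbit maps are right
translations, so this makes fundamental fields span the vertical directions. -/
theorem exists_tangentMap_mul_right_eq (g : G) (v : EG) :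
    ∃ ξ : EG, tangentMap EG EG (fun h : G => h * g) 1 ξ = v := by
  refine ⟨tangentMap EG EG (fun h : G => h * g⁻¹) g v, ?_⟩
  have h1 := LCDiffAt.tangentMap_comp (f := fun h : G => h * g⁻¹) (g := fun h : G => h * g)
    ((mSmooth_mul_right (EG := EG) g).lcDiffAt (g * g⁻¹))
    ((mSmooth_mul_right (EG := EG) g⁻¹).lcDiffAt g) v
  simp only [inv_mul_cancel_right, tangentMap_id] at h1
  rw [mul_inv_cancel] at h1
  exact h1.symm

namespace IsPrincipalBundle

variable {π : P → B}

/-- The unit section of a local trivialisation. -/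
theorem exists_local_section (h : IsPrincipalBundle EG G EP EB π)
    (b : B) : ∃ (U : Set B) (s : B → P), IsOpen U ∧ b ∈ U ∧
    MSmoothOn EB EP s U ∧ ∀ x ∈ U, π (s x) = x := by
  obtain ⟨U, e, hb, hU, hsource, htarget, -, hes, hpr, -⟩ := h.locally_trivial b
  have hmem : ∀ x ∈ U, ((1 : G), x) ∈ e.target := fun x hx => by
    rw [htarget]
    exact ⟨mem_univ _, hx⟩
  refine ⟨U, fun x => e.symm (1, x), hU, hb, ?_, fun x hx => ?_⟩
  · have h1 : MSmooth EB (EG × EB) (fun x : B => ((1 : G), x)) :=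
      MSmooth.prodMk (mSmoothOn_const 1) (mSmoothOn_id univ)
    exact hes.comp (MSmoothOn.mono h1 (subset_univ U)) hU e.open_target hmem
  · rw [← hpr _ (e.map_target (hmem x hx)), e.right_inv (hmem x hx)]

theorem proj_smul (h : IsPrincipalBundle EG G EP EB π)
    (g : G) (p : P) : π (g • p) = π p := by
  obtain ⟨U, e, hb, hU, hsource, -, -, -, hpr, heq⟩ := h.locally_trivial (π p)
  have hp : p ∈ e.source := by rwa [hsource]
  rw [← hpr _ (heq g p hp).1, (heq g p hp).2, hpr p hp]

theorem exists_smul_eq (h : IsPrincipalBundle EG G EP EB π)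
    {p q : P} (hpq : π p = π q) : ∃ g : G, g • p = q := by
  obtain ⟨U, e, hb, hU, hsource, -, -, -, hpr, heq⟩ := h.locally_trivial (π p)
  have hp : p ∈ e.source := by rwa [hsource]
  have hq : q ∈ e.source := by rwa [hsource, mem_preimage, ← hpq]
  refine ⟨(e q).1 * (e p).1⁻¹, e.injOn (heq _ p hp).1 hq ?_⟩
  rw [(heq _ p hp).2, inv_mul_cancel_right]
  exact Prod.ext rfl (by rw [hpr p hp, hpr q hq, hpq])

theorem tangentMap_proj_actT (h : IsPrincipalBundle EG G EP EB π)
    (g : G) (p : P) (X : EP) :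
    tangentMap EP EB π (g • p) (actT EP g p X) = tangentMap EP EB π p X := by
  unfold actT
  rw [← LCDiffAt.tangentMap_comp (h.smooth_proj.lcDiffAt (g • p))
    ((h.smooth_action.mSmooth_smul g).lcDiffAt p)]
  simp only [h.proj_smul]

/-- Vertical tangent vectors are values of fundamental vector fields. -/
theorem exists_fund_eq (h : IsPrincipalBundle EG G EP EB π)
    {p : P} {X : EP} (hX : tangentMap EP EB π p X = 0) :
    ∃ ξ : EG, fund G EP ξ p = X := by
  obtain ⟨U, e, hb, hU, hsource, -, he, hes, hpr, heq⟩ := h.locally_trivial (π p)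
  have hp : p ∈ e.source := by rwa [hsource]
  have hep := he.lcDiffAt e.open_source hp
  have hsp := hes.lcDiffAt e.open_target (e.map_source hp)
  -- The `B`-component of the trivialisation is `π`, so a vertical vector has only a component along
  -- `G`.
  have h2 : (tangentMap EP (EG × EB) e p X).2 = 0 := by
    rw [← (lcDiffAt_snd (E := EG) (E' := EB) (e p)).2,
      ← LCDiffAt.tangentMap_comp (lcDiffAt_snd (e p)).1 hep, ← hX]
    refine tangentMap_congr ?_ X
    filter_upwards [e.open_source.mem_nhds hp] with q hq using hpr q hq
  obtain ⟨ξ, hξ⟩ := exists_tangentMap_mul_right_eq (e p).1 (tangentMap EP (EG × EB) e p X).1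
  refine ⟨ξ, ?_⟩
  have h3 : ∀ g : G, g • p = e.symm (g * (e p).1, (e p).2) := fun g => by
    rw [← (heq g p hp).2, e.left_inv (heq g p hp).1]
  have h4 : MSmooth EG (EG × EB) (fun g : G => (g, (e p).2)) :=
    MSmooth.prodMk (mSmoothOn_id univ) (mSmoothOn_const _)
  have h5 : LCDiffAt EG (EG × EB) (fun g : G => (g * (e p).1, (e p).2)) 1 :=
    (h4.comp (mSmooth_mul_right (e p).1)).lcDiffAt 1
  have h6 : ((1 : G) * (e p).1, (e p).2) = e p := by rw [one_mul]
  unfold fund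
  simp only [h3]
  rw [LCDiffAt.tangentMap_comp (f := fun g : G => (g * (e p).1, (e p).2)) (by rwa [h6]) h5, h6,
    LCDiffAt.tangentMap_comp (g := fun g : G => (g, (e p).2)) (h4.lcDiffAt _)
      ((mSmooth_mul_right (e p).1).lcDiffAt 1), hξ, tangentMap_prodMk_const, ← h2, Prod.mk.eta,
    ← LCDiffAt.tangentMap_comp hsp hep, tangentMap_congr (g := fun q : P => q), tangentMap_id]
  filter_upwards [e.open_source.mem_nhds hp] with q hq using e.left_inv hq

end IsPrincipalBundle

end Bundle

/-! ### Descent of basic forms and the Kempf–Ness form -/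

section Cartan

variable {EG : Type*} [AddCommGroup EG] [Module ℝ EG] [TopologicalSpace EG] [LocConvex EG]
  {G : Type*} [Group G] [TopologicalSpace G] [ChartedSpace EG G] [LCLieGroup EG G]
  {𝔞 : Type*} [LieRing 𝔞] [LieAlgebra ℝ 𝔞] [TopologicalSpace 𝔞] [LocConvex 𝔞]
  {𝔤' : Type*} [AddCommGroup 𝔤'] [Module ℝ 𝔤'] [TopologicalSpace 𝔤'] [LocConvex 𝔤']
  {EM : Type*} [AddCommGroup EM] [Module ℝ EM] [TopologicalSpace EM] [LocConvex EM]
  {M : Type*} [TopologicalSpace M] [ChartedSpace EM M] [LCManifold EM M] [MulAction G M]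
  {EP : Type*} [AddCommGroup EP] [Module ℝ EP] [TopologicalSpace EP] [LocConvex EP]
  {P : Type*} [TopologicalSpace P] [ChartedSpace EP P] [LCManifold EP P] [MulAction G P]
  {EB : Type*} [AddCommGroup EB] [Module ℝ EB] [TopologicalSpace EB] [LocConvex EB]
  {B : Type*} [TopologicalSpace B] [ChartedSpace EB B] [LCManifold EB B]
  {K : KleinPair EG G 𝔞} {C : CartanGeometry EP P EB B K}

namespace CartanGeometry

/-- Transport `X` by the group element carrying `p` to `q`; the result differs from `Y` by a
vertical vector. So a basic form sees only the projected vector. -/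
theorem IsBasic.apply_eq {α : OneForm EP P ℝ} (hα : C.IsBasic α) {p q : P} {X Y : EP}
    (hpq : C.π p = C.π q) (hXY : tangentMap EP EB C.π p X = tangentMap EP EB C.π q Y) :
    α p X = α q Y := by
  obtain ⟨g, rfl⟩ := C.isPrincipal.exists_smul_eq hpq
  have hπ := C.isPrincipal.smooth_proj.lcDiffAt (g • p)
  rw [← hα.2 g p X, ← sub_eq_zero, ← map_sub]
  refine hα.1 _ _ ?_
  have h1 := hπ.tangentLin.map_sub (actT EP g p X) Y
  change tangentMap EP EB C.π (g • p) _ = tangentMap EP EB C.π (g • p) _ -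
    tangentMap EP EB C.π (g • p) _ at h1
  rw [h1, C.isPrincipal.tangentMap_proj_actT, hXY, sub_self]

theorem tangentMap_proj_section {U : Set B} {s : B → P} (hU : IsOpen U)
    (hs : MSmoothOn EB EP s U) (hπs : ∀ x ∈ U, C.π (s x) = x) {x : B} (hx : x ∈ U) (v : EB) :
    tangentMap EP EB C.π (s x) (tangentMap EB EP s x v) = v := by
  rw [← LCDiffAt.tangentMap_comp (C.isPrincipal.smooth_proj.lcDiffAt _) (hs.lcDiffAt hU hx),
    tangentMap_congr (g := fun y => y), tangentMap_id]
  filter_upwards [hU.mem_nhds hx] with y hy using hπs y hy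

/-- Since `π ∘ s` is the identity, the form on the base is locally `s^* α`; smoothness, uniqueness
and closedness downstairs all follow from this. -/
theorem Induces.isPullbackOn {α : OneForm EP P ℝ} {β : OneForm EB B ℝ} (h : C.Induces α β)
    {U : Set B} {s : B → P} (hU : IsOpen U) (hs : MSmoothOn EB EP s U)
    (hπs : ∀ x ∈ U, C.π (s x) = x) : β.IsPullbackOn α s U := fun x hx v => by
  rw [h, tangentMap_proj_section hU hs hπs hx, hπs x hx]

theorem Induces.isSmooth {α : OneForm EP P ℝ} {β : OneForm EB B ℝ} (h : C.Induces α β)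
    (hα : α.IsSmooth) : β.IsSmooth := by
  intro e he
  refine bSmooth_of_locally (e.open_target.prod isOpen_univ) fun z hz => ?_
  obtain ⟨U, s, hU, hzU, hs, hπs⟩ := C.isPrincipal.exists_local_section (e.symm z.1)
  refine ⟨_, (MSmoothOn.isOpen_chart_domain hs.1 hU e (chartAt EP (s (e.symm z.1)))).prod
    isOpen_univ, ⟨⟨hz.1, hzU, mem_chart_source EP _⟩, mem_univ _⟩,
    ((h.isPullbackOn hU hs hπs).bSmooth_rep hU hs hα he (chart_mem_atlas EP _)).mono
      inter_subset_right⟩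

theorem Induces.unique {α : OneForm EP P ℝ} {β β' : OneForm EB B ℝ} (h : C.Induces α β)
    (h' : C.Induces α β') : β' = β := by
  funext b
  ext v
  obtain ⟨U, s, hU, hb, hs, hπs⟩ := C.isPrincipal.exists_local_section b
  rw [h.isPullbackOn hU hs hπs b hb, h'.isPullbackOn hU hs hπs b hb]

theorem Induces.d_eq_zero {α : OneForm EP P ℝ} {β : OneForm EB B ℝ} (h : C.Induces α β)
    (hα : α.IsSmooth) (hd : ∀ p X Y, α.d p X Y = 0) (b : B) (X Y : EB) : β.d b X Y = 0 := by
  obtain ⟨U, s, hU, hb, hs, hπs⟩ := C.isPrincipal.exists_local_section b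
  rw [(h.isPullbackOn hU hs hπs).d_eq hU hs hα hb, hd]

/-- At each `b` the form is `s^* α` for a section chosen around `b`; the choices need not be
compatible, because `α` is basic. -/
theorem IsBasic.exists_induces {α : OneForm EP P ℝ} (hα : C.IsBasic α) :
    ∃ β : OneForm EB B ℝ, C.Induces α β := by
  choose U s hU hb hs hπs using C.isPrincipal.exists_local_section
  refine ⟨fun b => (α (s b b)).comp ((hs b).lcDiffAt (hU b) (hb b)).tangentLin, fun p X => ?_⟩
  refine hα.apply_eq (hπs _ _ (hb _)).symm ?_
  exact (tangentMap_proj_section (hU _) (hs _) (hπs _) (hb _) _).symm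

namespace OrbitModel

variable {m : M} (O : C.OrbitModel EM m) {J : M → 𝔤'}
  {D : LieDuality EG G 𝔤'} (κ : KleinDuality K D)

theorem bSmooth_momentum (hJ : MSmooth EM 𝔤' J)
    {e : OpenPartialHomeomorph P EP} (he : e ∈ atlas EP P) :
    BSmooth (fun y => J (O.χ (e.symm y))) e.target :=
  mSmoothOn_iff_bSmooth.1 (MSmoothOn.comp (g := fun p => J (O.χ p)) (hJ.comp O.smooth_χ)
    (mSmoothOn_chart_symm he) e.open_target isOpen_univ (mapsTo_univ _ _))

theorem kempfNessForm_isSmooth (hJ : MSmooth EM 𝔤' J) : (O.kempfNessForm J κ).IsSmooth := by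
  intro e he
  exact BSmooth.comp (g := fun z : 𝔤' × 𝔞 => κ.pair z.1 z.2)
    (f := fun z : EP × EP => (J (O.χ (e.symm z.1)), C.θ.rep e z.1 z.2))
    (bSmooth_bilinear κ.continuous_pair univ)
    ((O.bSmooth_momentum hJ he).fst_prod.prodMk (C.smooth_θ e he))
    (e.open_target.prod isOpen_univ) isOpen_univ (mapsTo_univ _ _)

/-- The Leibniz rule for the pairing. Writing `X = θ_p⁻¹ (θ_p X)` turns the derivative of `J ∘ χ`
into the Calabi operator. -/
theorem dirDeriv_kempfNessForm_rep (hJ : MSmooth EM 𝔤' J)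
    (p : P) (X Y : EP) :
    dirDeriv (fun y => (O.kempfNessForm J κ).rep (chartAt EP p) y Y) (chartAt EP p p) X =
      κ.pair (J (O.χ p))
        (dirDeriv (fun y => C.θ.rep (chartAt EP p) y Y) (chartAt EP p p) X) +
      κ.pair (O.calabi J p (C.θ p X)) (C.θ p Y) := by
  set e := chartAt EP p
  have he : e ∈ atlas EP P := chart_mem_atlas EP p
  have hp : p ∈ e.source := mem_chart_source EP p
  have hep : e p ∈ e.target := e.map_source hp
  have hj := O.bSmooth_momentum hJ he
  have hT : BSmooth (fun y => C.θ.rep e y Y) e.target :=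
    BSmooth.comp (g := fun z : EP × EP => C.θ.rep e z.1 z.2) (f := fun y => (y, Y))
      (C.smooth_θ e he) ((bSmooth_id _).prodMk (bSmooth_const Y _)) e.open_target
      (e.open_target.prod isOpen_univ) fun y hy => ⟨hy, mem_univ _⟩
  have hκ := (bSmooth_bilinear κ.continuous_pair univ).sDiffAt isOpen_univ
    (mem_univ (J (O.χ (e.symm (e p))), C.θ.rep e (e p) Y))
  have hjs := hj.sDiffAt e.open_target hep
  have hTs := hT.sDiffAt e.open_target hep
  have h1 : dirDeriv (fun y => J (O.χ (e.symm y))) (e p) X = O.calabi J p (C.θ p X) := by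
    have h2 : dirDeriv (fun y => J (O.χ (e.symm y))) (e p) X =
      tangentMap EP 𝔤' (fun q => J (O.χ q)) p X := rfl
    rw [h2, LCDiffAt.tangentMap_comp (hJ.lcDiffAt _) (O.smooth_χ.lcDiffAt p)]
    unfold calabi ρ
    congr 2
    exact ((C.iso p).symm_apply_apply X).symm
  have h3 : (fun y => (O.kempfNessForm J κ).rep e y Y) =
    fun y => κ.pair (J (O.χ (e.symm y))) (C.θ.rep e y Y) := rfl
  rw [h3, SDiffAt.dirDeriv_comp (g := fun z : 𝔤' × 𝔞 => κ.pair z.1 z.2)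
    (f := fun y => (J (O.χ (e.symm y)), C.θ.rep e y Y)) hκ
    ((hj.prodMk hT).sDiffAt e.open_target hep), hjs.dirDeriv_prodMk hTs,
    (hasDirDeriv_bilinear κ.pair _ _).dirDeriv_eq, h1]
  simp only
  rw [C.θ.rep_chartAt, e.left_inv hp]

theorem kempfNessForm_d (hJ : MSmooth EM 𝔤' J)
    (hequiv : O.IsEquivariantMomentum J κ) (p : P) (X Y : EP) :
    (O.kempfNessForm J κ).d p X Y = κ.pair (J (O.χ p)) (C.Ω p X Y) := by
  have h1 : (O.kempfNessForm J κ).d p X Y =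
    dirDeriv (fun y => (O.kempfNessForm J κ).rep (chartAt EP p) y Y) (chartAt EP p p) X -
    dirDeriv (fun y => (O.kempfNessForm J κ).rep (chartAt EP p) y X) (chartAt EP p p) Y := rfl
  have h2 : C.θ.d p X Y =
    dirDeriv (fun y => C.θ.rep (chartAt EP p) y Y) (chartAt EP p p) X -
    dirDeriv (fun y => C.θ.rep (chartAt EP p) y X) (chartAt EP p p) Y := rfl
  -- By skew-symmetry `[θ ∧ θ](X, Y)` is twice the bracket, which absorbs the factor `1 / 2`.
  have h3 : (1 / 2 : ℝ) • C.wedgeBracket p X Y = ⁅C.θ p X, C.θ p Y⁆ := by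
    unfold wedgeBracket
    rw [← lie_skew (C.θ p Y) (C.θ p X), sub_neg_eq_add, ← two_smul ℝ, smul_smul]
    norm_num
  rw [h1, O.dirDeriv_kempfNessForm_rep κ hJ, O.dirDeriv_kempfNessForm_rep κ hJ, Ω, h2, h3,
    map_sub, map_sub]
  -- Equivariance replaces the two Calabi terms by the bracket term of the curvature.
  linarith [hequiv.calabi_eq p (C.θ p X) (C.θ p Y)]

theorem kempfNessForm_isBasic (hequiv : O.IsEquivariantMomentum J κ) :
    C.IsBasic (O.kempfNessForm J κ) := by
  refine ⟨fun p X hX => ?_, fun g p X => ?_⟩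
  · obtain ⟨ξ, rfl⟩ := C.isPrincipal.exists_fund_eq hX
    change κ.pair (J (O.χ p)) (C.iso p (fund G EP ξ p)) = 0
    rw [C.fundamental, κ.vanish]
  · change κ.pair (J (O.χ (g • p))) (C.iso (g • p) (actT EP g p X)) =
      κ.pair (J (O.χ p)) (C.iso p X)
    -- Testing the cocycle against `Ad_g (θ_p X)` lets the coadjoint term be simplified by
    -- invariance of the pairing.
    have h1 := hequiv.cocycle_eq g (O.χ p) (K.Ad g (C.iso p X))
    rw [cocycle, map_sub, LinearMap.sub_apply, κ.invariant, sub_eq_zero] at h1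
    rw [C.equivariant, O.equivariant, h1]

end OrbitModel

end CartanGeometry

end Cartan

end LCGeom

theorem mainTheorem2
    -- the Lie group `G`
    {EG : Type*} [AddCommGroup EG] [Module ℝ EG] [TopologicalSpace EG] [LocConvex EG]
    {G : Type*} [Group G] [TopologicalSpace G] [ChartedSpace EG G] [LCLieGroup EG G]
    -- the Lie algebra `𝔞` and the dual space `𝔤'` of the Lie algebra of `G`
    {𝔞 : Type*} [LieRing 𝔞] [LieAlgebra ℝ 𝔞] [TopologicalSpace 𝔞] [LocConvex 𝔞]
    {𝔤' : Type*} [AddCommGroup 𝔤'] [Module ℝ 𝔤'] [TopologicalSpace 𝔤'] [LocConvex 𝔤']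
    -- the manifolds `M`, `P` and `B`
    {EM : Type*} [AddCommGroup EM] [Module ℝ EM] [TopologicalSpace EM] [LocConvex EM]
    {M : Type*} [TopologicalSpace M] [ChartedSpace EM M] [LCManifold EM M] [MulAction G M]
    {EP : Type*} [AddCommGroup EP] [Module ℝ EP] [TopologicalSpace EP] [LocConvex EP]
    {P : Type*} [TopologicalSpace P] [ChartedSpace EP P] [LCManifold EP P] [MulAction G P]
    {EB : Type*} [AddCommGroup EB] [Module ℝ EB] [TopologicalSpace EB] [LocConvex EB]
    {B : Type*} [TopologicalSpace B] [ChartedSpace EB B] [LCManifold EB B]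
    -- the symplectic action and its momentum map
    (ω : SymplecticForm EM M) (_hω : IsSymplecticAction EG G ω)
    (D : LieDuality EG G 𝔤') (J : M → 𝔤') (_hJ : IsMomentumMap D ω J)
    -- the Cartan model for an orbit through `m`
    (K : KleinPair EG G 𝔞) (κ : KleinDuality K D)
    (C : CartanGeometry EP P EB B K) (m : M) (O : C.OrbitModel EM m)
    (_hequiv : O.IsEquivariantMomentum J κ) :
    -- the form is basic
    (O.kempfNessForm J κ).IsSmooth ∧ C.IsBasic (O.kempfNessForm J κ) ∧
    -- its exterior derivative
    (∀ (p : P) (X Y : EP),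
      (O.kempfNessForm J κ).d p X Y = κ.pair (J (O.χ p)) (C.Ω p X Y)) ∧
    -- it induces a unique form `β` on `B`
    ∃ β : OneForm EB B ℝ, β.IsSmooth ∧ C.Induces (O.kempfNessForm J κ) β ∧
      (∀ β' : OneForm EB B ℝ, C.Induces (O.kempfNessForm J κ) β' → β' = β) ∧
      (C.TorsionFree →
        (∀ (p : P) (X Y : EP), (O.kempfNessForm J κ).d p X Y = 0) ∧
        (∀ (b : B) (X Y : EB), β.d b X Y = 0) ∧
        -- the Kempf--Ness function, unique up to a constant
        (SimplyConnectedSpace B →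
          ∃ Ψ : B → ℝ, MSmooth EB ℝ Ψ ∧
            (∀ (b : B) (X : EB), tangentMap EB ℝ Ψ b X = β b X) ∧
            ∀ Ψ' : B → ℝ, MSmooth EB ℝ Ψ' →
              (∀ (b : B) (X : EB), tangentMap EB ℝ Ψ' b X = β b X) →
              ∃ c : ℝ, ∀ b, Ψ' b = Ψ b + c)) := by
  have hsm := O.kempfNessForm_isSmooth κ _hJ.smooth
  have hbasic := O.kempfNessForm_isBasic κ _hequiv
  have hd := O.kempfNessForm_d κ _hJ.smooth _hequiv
  obtain ⟨β, hβ⟩ := hbasic.exists_induces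
  have hβs := hβ.isSmooth hsm
  refine ⟨hsm, hbasic, hd, β, hβs, hβ, fun β' hβ' => hβ.unique hβ', fun hT => ?_⟩
  have hd0 : ∀ (p : P) (X Y : EP), (O.kempfNessForm J κ).d p X Y = 0 := fun p X Y => by
    -- Torsion-freeness puts the curvature in `𝔤`, on which the pairing vanishes.
    obtain ⟨ξ, hξ⟩ := hT p X Y
    rw [hd, ← hξ, κ.vanish]
  have hβd := hβ.d_eq_zero hsm hd0
  refine ⟨hd0, hβd, fun _ => ?_⟩
  obtain ⟨Ψ, hΨ, hΨβ⟩ := OneForm.exists_primitive hβs hβd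
  refine ⟨Ψ, hΨ, hΨβ, fun Ψ' hΨ' hΨβ' => ?_⟩
  exact exists_eq_add_const_of_tangentMap_eq hΨ' hΨ fun x v => by rw [hΨβ, hΨβ']
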